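/- **Setting.** Let $d\ge 0$ and let $A\in\mathbb R^{d\times d}$ be symmetric. For $\epsilon\in(0,1)$ call $A$ *$\epsilon$-far from PSD* if $A\neq 0$ and $\lambda_{\min}(A)\le-\epsilon\|A\|_F$. A *non-adaptive vector-matrix-vector algorithm* chooses, from its random seed alone, pairs $(v_i,w_i)$ of vectors in $\mathbb R^d$, receives the values $v_i^TAw_i$, and outputs True or False; its number of queries is the number of pairs. It is a *two-sided $(\epsilon,\ell_2)$-tester correct with probability $0.9$* if, for every symmetric $A$, it outputs True with probability at least $0.9$ when $A$ is PSD, and outputs False with probability at least $0.9$ when $A$ is $\epsilon$-far from PSD (errors on both sides are allowed). **The test.** Let $G\in\mathbb R^{d\times k}$ and $H\in\mathbb R^{d\times m}$ have independent $\mathcal N(0,1)$ entries (all entries of $[G\mid H]$ are independent), and let $\alpha$ and $\beta$ be given by measurable real-valued functions of $H^TAH$. If $G^TAG$ is not PSD, output False. Otherwise put $$\gamma=\frac{\alpha-\lambda_{\min}(G^TAG)}{\beta\sqrt k\,\log k}$$ ($\gamma=0$ if the denominator is $0$), and output True if and only if $\gamma\le c_{\mathrm{psd}}$. This test depends on $A$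 only through the sketch $[G\mid H]^TA[G\mid H]$, whose $(k+m)^2$ entries are non-adaptive vector-matrix-vector queries. **Theorem.** There are absolute constants $m\in\mathbb N$ and $c_{\mathrm{psd}},C>0$ and measurable functions $\alpha=\alpha(H^TAH)$, $\beta=\beta(H^TAH)$, none of them depending on $\epsilon$, $d$ or $A$, such that: 1. for every $d$ and every symmetric $A\in\mathbb R^{d\times d}$, each of the events $|\alpha-\mathrm{Tr}(A)|\le\|A\|_F$ and $\tfrac12\|A\|_F\le\beta\le 2\|A\|_F$ has probability at least $0.99$; 2. for every $\epsilon\in(0,1)$ there is an integer $k\ge1$, depending only on $\epsilon$, with $k+m\le C\epsilon^{-2}\log^2(2/\epsilon)$, such that for every $d$ the test above is a two-sided $(\epsilon,\ell_2)$-tester correct with probability $0.9$, and its number of non-adaptive vector-matrix-vector queries is at most $C\epsilon^{-4}\log^4(2/\epsilon)=\widetilde O(1/\epsilon^4)$. -/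

import Mathlib

open MeasureTheory ProbabilityTheory

noncomputable section

namespace PSDTesting

/-- The smallest eigenvalue of a (symmetric) real matrix of positive size. For such a matrix the
spectrum is a finite nonempty set of reals, so the infimum is a minimum. -/
def lambdaMin {ι : Type} [Fintype ι] [DecidableEq ι] (M : Matrix ι ι ℝ) : ℝ :=
  sInf (spectrum ℝ M)

/-- The Frobenius norm `‖M‖_F`, that is, the Schatten 2-norm. -/
def frobNorm {ι κ : Type} [Fintype ι] [Fintype κ] (M : Matrix ι κ ℝ) : ℝ :=
  Real.sqrt (∑ i, ∑ j, M i j ^ 2)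

/-- `A` is `ε‖A‖_F`-far from the PSD cone: `λ_min(A) ≤ -ε ‖A‖_F`. The zero matrix, which is PSD
but satisfies this inequality as an equality, is not counted as far. -/
def IsFarFromPSD {d : ℕ} (ε : ℝ) (A : Matrix (Fin d) (Fin d) ℝ) : Prop :=
  A ≠ 0 ∧ lambdaMin A ≤ -(ε * frobNorm A)

/-- A randomized non-adaptive algorithm in the vector-matrix-vector query model for `d × d`
matrices, with queries indexed by `ι`. It draws a seed `ω`; the seed alone fixes all query pairs
`(left i ω, right i ω)`; the answer to query `i` is `(left i ω)ᵀ A (right i ω)`; the algorithm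
outputs True when `accept` holds of the seed and the list of answers, and False otherwise. -/
structure NonadaptiveVMV (d : ℕ) (ι : Type) where
  Ω : Type
  [measurableSpace : MeasurableSpace Ω]
  μ : Measure Ω
  [isProb : IsProbabilityMeasure μ]
  left : ι → Ω → (Fin d → ℝ)
  right : ι → Ω → (Fin d → ℝ)
  measurable_left : ∀ i, Measurable (left i)
  measurable_right : ∀ i, Measurable (right i)
  accept : Ω → (ι → ℝ) → Prop

namespace NonadaptiveVMV

variable {d : ℕ} {ι : Type}

/-- The answers to the queries on the input `A` with seed `ω`. -/
def answers (T : NonadaptiveVMV d ι) (A : Matrix (Fin d) (Fin d) ℝ) (ω : T.Ω) : ι → ℝ :=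
  fun i => dotProduct (T.left i ω) (A.mulVec (T.right i ω))

/-- The event that the algorithm outputs True on the input `A`; its complement is the event that
it outputs False. -/
def outputsTrue (T : NonadaptiveVMV d ι) (A : Matrix (Fin d) (Fin d) ℝ) : Set T.Ω :=
  {ω | T.accept ω (T.answers A ω)}

/-- The number of vector-matrix-vector queries. -/
def numQueries [Fintype ι] (_T : NonadaptiveVMV d ι) : ℕ := Fintype.card ι

/-- `T` is a (two-sided) `(ε, ℓ₂)`-tester which is correct with probability at least `p`: on every
PSD input it outputs True, and on every input that is `ε`-far from PSD it outputs False, with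
probability at least `p`. Errors on both sides are allowed. -/
def IsL2Tester (T : NonadaptiveVMV d ι) (ε p : ℝ) : Prop :=
  letI := T.measurableSpace
  ∀ A : Matrix (Fin d) (Fin d) ℝ, A.IsSymm →
    MeasurableSet (T.outputsTrue A) ∧
    (A.PosSemidef → p ≤ T.μ.real (T.outputsTrue A)) ∧
    (IsFarFromPSD ε A → p ≤ T.μ.real (T.outputsTrue A)ᶜ)

end NonadaptiveVMV

/-- The Borel (product) sigma-algebra on real matrices. -/
instance instMeasurableSpaceRealMatrix (ι κ : Type) : MeasurableSpace (Matrix ι κ ℝ) :=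
  inferInstanceAs (MeasurableSpace (ι → κ → ℝ))

/-- The law of a random `d × κ` matrix with independent `N(0,1)` entries. -/
def gaussianMatrix (d : ℕ) (κ : Type) [Fintype κ] : Measure (Matrix (Fin d) κ ℝ) :=
  Measure.pi fun _ : Fin d => Measure.pi fun _ : κ => gaussianReal 0 1

instance instIsProbGaussianMatrix (d : ℕ) (κ : Type) [Fintype κ] :
    IsProbabilityMeasure (gaussianMatrix d κ) := by
  unfold gaussianMatrix
  exact inferInstanceAs (IsProbabilityMeasure
    (Measure.pi fun _ : Fin d => Measure.pi fun _ : κ => gaussianReal 0 1))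

/-- The bilinear sketch `Gᵀ A G`. -/
def bilinearSketch {d : ℕ} {κ : Type} (A : Matrix (Fin d) (Fin d) ℝ) (G : Matrix (Fin d) κ ℝ) :
    Matrix κ κ ℝ :=
  G.transpose * A * G

/-- The statistic `γ = (α - λ_min(S)) / (β √k log k)` of a `k × k` sketch `S`, for an estimate `α`
of the trace and an estimate `β` of the Frobenius norm of the input. (It is `0` when `β = 0`.) -/
def gammaStat {k : ℕ} (α β : ℝ) (S : Matrix (Fin k) (Fin k) ℝ) : ℝ :=
  (α - lambdaMin S) / (β * Real.sqrt k * Real.log k)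

/-- The decision rule, as a function of the bilinear sketch `S = Xᵀ A X` of the input `A` with a
matrix `X = [G | H]` of `k + m` columns, so that `S.toBlocks₁₁ = Gᵀ A G` and
`S.toBlocks₂₂ = Hᵀ A H`. The `m` columns of `H` serve to compute the estimates `α = trEst (Hᵀ A H)`
and `β = frEst (Hᵀ A H)`. The output is True if and only if `Gᵀ A G` is PSD and `γ ≤ c`. -/
def sketchAccepts {k m : ℕ} (trEst frEst : Matrix (Fin m) (Fin m) ℝ → ℝ) (c : ℝ)
    (S : Matrix (Fin k ⊕ Fin m) (Fin k ⊕ Fin m) ℝ) : Prop :=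
  S.toBlocks₁₁.PosSemidef ∧
    gammaStat (trEst S.toBlocks₂₂) (frEst S.toBlocks₂₂) S.toBlocks₁₁ ≤ c

/-- The Gaussian bilinear sketch as a non-adaptive algorithm: the seed is a Gaussian
`d × (k + m)` matrix `X`, the query with index `(i, j)` is the pair (column `i`, column `j`) of
`X`, so that the answers are precisely the entries of `Xᵀ A X`, and the decision depends only
on them. -/
def sketchTester (d k m : ℕ) (trEst frEst : Matrix (Fin m) (Fin m) ℝ → ℝ) (c : ℝ) :
    NonadaptiveVMV d ((Fin k ⊕ Fin m) × (Fin k ⊕ Fin m)) where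
  Ω := Matrix (Fin d) (Fin k ⊕ Fin m) ℝ
  μ := gaussianMatrix d (Fin k ⊕ Fin m)
  left q X := fun r => X r q.1
  right q X := fun r => X r q.2
  measurable_left q :=
    measurable_pi_lambda _ fun r => (measurable_pi_apply q.1).comp (measurable_pi_apply r)
  measurable_right q :=
    measurable_pi_lambda _ fun r => (measurable_pi_apply q.2).comp (measurable_pi_apply r)
  accept _ a := sketchAccepts trEst frEst c (Matrix.of fun i j => a (i, j))

/-- The answers that the sketch tester receives form the bilinear sketch. -/
theorem sketchTester_outputsTrue (d k m : ℕ) (trEst frEst : Matrix (Fin m) (Fin m) ℝ → ℝ) (c : ℝ)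
    (A : Matrix (Fin d) (Fin d) ℝ) :
    (sketchTester d k m trEst frEst c).outputsTrue A =
      {X : Matrix (Fin d) (Fin k ⊕ Fin m) ℝ |
        sketchAccepts trEst frEst c (bilinearSketch A X)} := by
  have h : ∀ X : Matrix (Fin d) (Fin k ⊕ Fin m) ℝ,
      (Matrix.of fun i j => (sketchTester d k m trEst frEst c).answers A X (i, j)) =
        bilinearSketch A X := by
    intro X
    ext i j
    simp only [NonadaptiveVMV.answers, sketchTester, bilinearSketch, Matrix.of_apply,
      Matrix.mul_assoc]
    simp only [Matrix.mul_apply, dotProduct, Matrix.mulVec, Matrix.transpose_apply]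
  ext X
  change sketchAccepts trEst frEst c _ ↔ _
  rw [h X]
  rfl

end PSDTesting

end

namespace PSDTesting

open scoped NNReal ENNReal

/-! The Gaussian law is rotation invariant, so `A` may be replaced by the diagonal matrix of its
eigenvalues `a r` (`exists_diagonal_sketch`). The sketch is then `S = ∑ a_r g_r g_rᵀ` with
independent standard Gaussian rows `g_r`, and its mean is `Tr(A) · I`. Write `F` for `‖A‖_F`. The
test compares `Tr(A) - λ_min(S)` with `F √k log k`.

If `A` is PSD, each form `xᵀ S x` is a sum of nonnegative terms. For `u ≥ 0`, `exp(-u) ≤ 1 - u +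
u²/2`, so its lower tail is controlled by second and fourth moments alone and is sub-Gaussian at
scale `F`, with no term in the operator norm (`real_quadraticForm_lower_tail_le`). A union bound
over a grid of `exp(O(k log k))` points, and a crude Frobenius bound to pass from the grid to the
sphere, give `λ_min(S) ≥ Tr(A) - O(√k log k) F` (`real_lambdaMin_sketch_lt_le`).

If `A` has an eigenvalue `a_i ≤ -εF`, the row `x = g_i` is a good test vector. Its own term
contributes `a_i ‖x‖⁴`. The other rows are independent of `x`, so their contribution is `(Tr(A) -
a_i + O(F)) ‖x‖²` by Chebyshev. As `‖x‖²` is at least `k/2`, division by `‖x‖²` gives `λ_min(S) ≤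
Tr(A) + O(F) - εkF/2` (`real_lt_lambdaMin_sketch_le`).

The two cases separate once `εk` dominates `√k log k`, that is for `k` of order `ε⁻² log²(2/ε)`
(`sketchSize_large`). Constantly many further columns suffice to estimate `Tr(A)` and `F` by
Chebyshev, and `sketchTester_isL2Tester` combines the bounds. -/

/-! ### Moments of Gaussian variables and of linear functionals of Gaussian vectors. -/

theorem integral_pow_gaussianReal (v : ℝ≥0) (n : ℕ) :
    ∫ x, x ^ n ∂(gaussianReal 0 v) =
      iteratedDeriv n (fun t : ℝ => Real.exp (v * t ^ 2 / 2)) 0 := by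
  have h := iteratedDeriv_mgf_zero (X := id) (μ := gaussianReal 0 v)
    (by rw [integrableExpSet_id_gaussianReal]; simp) n
  rw [mgf_id_gaussianReal] at h
  simpa using h.symm

theorem iteratedDeriv_exp_sq (v : ℝ) :
    iteratedDeriv 2 (fun t : ℝ => Real.exp (v * t ^ 2 / 2)) 0 = v ∧
    iteratedDeriv 4 (fun t : ℝ => Real.exp (v * t ^ 2 / 2)) 0 = 3 * v ^ 2 := by
  have h0 : ∀ t, HasDerivAt (fun t : ℝ => Real.exp (v * t ^ 2 / 2))
      (v * t * Real.exp (v * t ^ 2 / 2)) t := by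
    intro t
    have := (((hasDerivAt_pow 2 t).const_mul v).div_const 2).exp
    convert this using 1
    push_cast; ring
  -- Every derivative is a polynomial times the same exponential, so one product rule drives all the
  -- steps.
  have key : ∀ (p p' : ℝ → ℝ), (∀ t, HasDerivAt p (p' t) t) →
      deriv (fun t => p t * Real.exp (v * t ^ 2 / 2)) =
        fun t => (p' t + p t * (v * t)) * Real.exp (v * t ^ 2 / 2) := by
    intro p p' hp
    funext t
    rw [((hp t).fun_mul (h0 t)).deriv]
    ring
  have e1 : iteratedDeriv 1 (fun t : ℝ => Real.exp (v * t ^ 2 / 2)) =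
      fun t => (v * t) * Real.exp (v * t ^ 2 / 2) := by
    rw [iteratedDeriv_one]; funext t; exact (h0 t).deriv
  have e2 : iteratedDeriv 2 (fun t : ℝ => Real.exp (v * t ^ 2 / 2)) =
      fun t => (v + v * t * (v * t)) * Real.exp (v * t ^ 2 / 2) := by
    rw [iteratedDeriv_succ, e1]
    exact key _ (fun _ => v) fun t => by simpa using (hasDerivAt_id t).const_mul v
  have e3 : iteratedDeriv 3 (fun t : ℝ => Real.exp (v * t ^ 2 / 2)) =
      fun t => (v ^ 2 * (2 * t) + (v + v * t * (v * t)) * (v * t)) *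
        Real.exp (v * t ^ 2 / 2) := by
    rw [iteratedDeriv_succ, e2]
    refine key _ (fun t => v ^ 2 * (2 * t)) fun t => ?_
    have h := ((hasDerivAt_pow 2 t).const_mul (v ^ 2)).const_add v
    rw [show (fun t => v + v * t * (v * t)) = fun t => v + v ^ 2 * t ^ 2 by funext t; ring]
    simpa using h
  have e4 : iteratedDeriv 4 (fun t : ℝ => Real.exp (v * t ^ 2 / 2)) =
      fun t => ((3 * v ^ 2 + v ^ 3 * (3 * t ^ 2)) +
        (v ^ 2 * (2 * t) + (v + v * t * (v * t)) * (v * t)) * (v * t)) *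
        Real.exp (v * t ^ 2 / 2) := by
    rw [iteratedDeriv_succ, e3]
    refine key _ (fun t => 3 * v ^ 2 + v ^ 3 * (3 * t ^ 2)) fun t => ?_
    have h := ((hasDerivAt_id' t).const_mul (3 * v ^ 2)).fun_add
      ((hasDerivAt_pow 3 t).const_mul (v ^ 3))
    rw [show (fun t => v ^ 2 * (2 * t) + (v + v * t * (v * t)) * (v * t)) =
      fun t => 3 * v ^ 2 * t + v ^ 3 * t ^ 3 by funext t; ring]
    simpa using h
  constructor
  · rw [e2]; simp
  · rw [e4]; simp

theorem integral_sq_gaussianReal (v : ℝ≥0) : ∫ x, x ^ 2 ∂(gaussianReal 0 v) = v := by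
  rw [integral_pow_gaussianReal, (iteratedDeriv_exp_sq v).1]

theorem integral_pow_four_gaussianReal (v : ℝ≥0) :
    ∫ x, x ^ 4 ∂(gaussianReal 0 v) = 3 * (v : ℝ) ^ 2 := by
  rw [integral_pow_gaussianReal, (iteratedDeriv_exp_sq v).2]

/-- The standard Gaussian law on `κ → ℝ`. -/
noncomputable abbrev stdPi (κ : Type) [Fintype κ] : Measure (κ → ℝ) :=
  Measure.pi fun _ : κ => gaussianReal 0 1

/-- A linear functional of a standard Gaussian vector is Gaussian. -/
theorem map_dotProduct_stdPi {κ : Type} [Fintype κ] (y : κ → ℝ) :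
    (stdPi κ).map (fun g => g ⬝ᵥ y) = gaussianReal 0 (∑ j, y j ^ 2).toNNReal := by
  have hv : (0 : ℝ) ≤ ∑ j, y j ^ 2 := Finset.sum_nonneg fun j _ => sq_nonneg _
  have hm : Measurable fun g : κ → ℝ => g ⬝ᵥ y := by
    unfold dotProduct; fun_prop
  have := Measure.isProbabilityMeasure_map (μ := stdPi κ) hm.aemeasurable
  -- Independence of the coordinates makes the characteristic function a product of one-dimensional
  -- Gaussian ones.
  apply Measure.ext_of_charFun
  ext t
  rw [charFun_gaussianReal, charFun_apply_real, integral_map hm.aemeasurable (by fun_prop)]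
  have h : ∀ g : κ → ℝ, Complex.exp (t * ((g ⬝ᵥ y : ℝ) : ℂ) * Complex.I) =
      ∏ j, Complex.exp ((t * y j : ℝ) * (g j : ℂ) * Complex.I) := by
    intro g
    rw [← Complex.exp_sum]
    congr 1
    simp only [dotProduct, Complex.ofReal_sum, Complex.ofReal_mul, Finset.mul_sum, Finset.sum_mul]
    exact Finset.sum_congr rfl fun j _ => by ring
  simp_rw [h]
  rw [integral_fintype_prod_eq_prod
    (f := fun j (x : ℝ) => Complex.exp ((t * y j : ℝ) * (x : ℂ) * Complex.I))]
  simp_rw [← charFun_apply_real, charFun_gaussianReal]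
  rw [← Complex.exp_sum]
  congr 1
  have : (((∑ j, y j ^ 2).toNNReal : ℝ) : ℂ) = ∑ j, (y j : ℂ) ^ 2 := by
    rw [Real.coe_toNNReal _ hv]; push_cast; rfl
  rw [this]
  simp only [Complex.ofReal_zero, Complex.ofReal_mul, mul_zero, zero_mul, zero_sub,
    NNReal.coe_one, Complex.ofReal_one, one_mul, Finset.sum_mul, Finset.sum_neg_distrib,
    Finset.sum_div]
  congr 1
  exact Finset.sum_congr rfl fun j _ => by ring

theorem measurable_dotProduct_right {κ : Type} [Fintype κ] (y : κ → ℝ) :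
    Measurable fun g : κ → ℝ => g ⬝ᵥ y := by
  unfold dotProduct; fun_prop

theorem memLp_dotProduct_stdPi {κ : Type} [Fintype κ] (y : κ → ℝ) (p : ℝ≥0) :
    MemLp (fun g => g ⬝ᵥ y) p (stdPi κ) := by
  have h := memLp_id_gaussianReal (μ := 0) (v := (∑ j, y j ^ 2).toNNReal) p
  rw [← map_dotProduct_stdPi] at h
  exact h.comp_of_map (measurable_dotProduct_right y).aemeasurable

theorem integral_dotProduct_pow_stdPi {κ : Type} [Fintype κ] (y : κ → ℝ) (n : ℕ) :
    ∫ g, (g ⬝ᵥ y) ^ n ∂(stdPi κ) = ∫ x, x ^ n ∂(gaussianReal 0 (∑ j, y j ^ 2).toNNReal) := by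
  rw [← map_dotProduct_stdPi, integral_map (measurable_dotProduct_right y).aemeasurable
    (by fun_prop)]

theorem integral_dotProduct_sq_stdPi {κ : Type} [Fintype κ] (y : κ → ℝ) :
    ∫ g, (g ⬝ᵥ y) ^ 2 ∂(stdPi κ) = ∑ j, y j ^ 2 := by
  rw [integral_dotProduct_pow_stdPi, integral_sq_gaussianReal,
    Real.coe_toNNReal _ (Finset.sum_nonneg fun j _ => sq_nonneg _)]

theorem integral_dotProduct_pow_four_stdPi {κ : Type} [Fintype κ] (y : κ → ℝ) :
    ∫ g, (g ⬝ᵥ y) ^ 4 ∂(stdPi κ) = 3 * (∑ j, y j ^ 2) ^ 2 := by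
  rw [integral_dotProduct_pow_stdPi, integral_pow_four_gaussianReal,
    Real.coe_toNNReal _ (Finset.sum_nonneg fun j _ => sq_nonneg _)]

theorem memLp_dotProduct_sq_stdPi {κ : Type} [Fintype κ] (y : κ → ℝ) :
    MemLp (fun g => (g ⬝ᵥ y) ^ 2) 2 (stdPi κ) := by
  rw [memLp_two_iff_integrable_sq (by have := measurable_dotProduct_right y; fun_prop)]
  have h := (memLp_dotProduct_stdPi y 4).integrable_norm_pow (p := 4) (by norm_num)
  refine h.congr (Filter.Eventually.of_forall fun g => ?_)
  simp only [Real.norm_eq_abs]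
  rw [← pow_mul, Even.pow_abs (by decide)]

theorem variance_dotProduct_sq_stdPi {κ : Type} [Fintype κ] (y : κ → ℝ) :
    Var[fun g => (g ⬝ᵥ y) ^ 2; stdPi κ] = 2 * (∑ j, y j ^ 2) ^ 2 := by
  rw [variance_eq_sub (memLp_dotProduct_sq_stdPi y)]
  simp only [Pi.pow_apply, ← pow_mul]
  rw [show (2 * 2 : ℕ) = 4 from rfl, integral_dotProduct_pow_four_stdPi,
    integral_dotProduct_sq_stdPi]
  ring

/-! ### Weighted sums over independent rows: mean, variance, fourth moment. -/

section RowSums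

variable {E : Type} [MeasurableSpace E] {ν : Measure E} [IsProbabilityMeasure ν] {f : E → ℝ}
  {ι : Type} [Fintype ι]

theorem memLp_rowSum {p : ℝ≥0∞} (hf : MemLp f p ν) (a : ι → ℝ) (s : Finset ι) :
    MemLp (fun X : ι → E => ∑ r ∈ s, a r * f (X r)) p (Measure.pi fun _ : ι => ν) :=
  memLp_finsetSum _ fun r _ =>
    (hf.comp_measurePreserving (measurePreserving_eval (fun _ : ι => ν) r)).const_mul (a r)

theorem integral_comp_eval_pi (g : E → ℝ) (hg : AEStronglyMeasurable g ν) (r : ι) :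
    ∫ X, g (X r) ∂(Measure.pi fun _ : ι => ν) = ∫ x, g x ∂ν := by
  have h := (measurePreserving_eval (fun _ : ι => ν) r)
  have h2 := integral_map (μ := Measure.pi fun _ : ι => ν) (φ := Function.eval r)
    h.measurable.aemeasurable (f := g) (by rw [h.map_eq]; exact hg)
  rw [h.map_eq] at h2
  exact h2.symm

theorem integral_rowSum (hf : Integrable f ν) (a : ι → ℝ) (s : Finset ι) :
    ∫ X, ∑ r ∈ s, a r * f (X r) ∂(Measure.pi fun _ : ι => ν) =
      (∑ r ∈ s, a r) * ∫ x, f x ∂ν := by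
  rw [integral_finsetSum, Finset.sum_mul]
  · refine Finset.sum_congr rfl fun r _ => ?_
    rw [integral_const_mul, integral_comp_eval_pi f hf.aestronglyMeasurable]
  · intro r _
    have := ((memLp_one_iff_integrable.2 hf).comp_measurePreserving
      (measurePreserving_eval (fun _ : ι => ν) r)).const_mul (a r)
    exact memLp_one_iff_integrable.1 this

theorem variance_rowSum (hf : MemLp f 2 ν) (a : ι → ℝ) :
    Var[fun X : ι → E => ∑ r, a r * f (X r); Measure.pi fun _ : ι => ν] =
      Var[f; ν] * ∑ r, a r ^ 2 := by
  have h := variance_sum_pi (μ := fun _ : ι => ν) (X := fun r x => a r * f x)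
    fun r => hf.const_mul (a r)
  rw [show (fun X : ι → E => ∑ r, a r * f (X r)) = ∑ r, fun X : ι → E => a r * f (X r) by
    funext X; simp, h, Finset.mul_sum]
  refine Finset.sum_congr rfl fun r _ => ?_
  rw [variance_const_mul, mul_comm]

theorem real_rowSum_deviation_le (hf : MemLp f 2 ν) (a : ι → ℝ) {t : ℝ} (ht : 0 < t) :
    (Measure.pi fun _ : ι => ν).real
      {X | t ≤ |∑ r, a r * f (X r) - (∑ r, a r) * ∫ x, f x ∂ν|} ≤
      Var[f; ν] * (∑ r, a r ^ 2) / t ^ 2 := by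
  have h := meas_ge_le_variance_div_sq (memLp_rowSum hf a Finset.univ) ht
  rw [integral_rowSum (hf.integrable (by norm_num)), variance_rowSum hf] at h
  refine ENNReal.toReal_le_of_le_ofReal ?_ h
  exact div_nonneg (mul_nonneg (variance_nonneg _ _) (Finset.sum_nonneg fun _ _ => sq_nonneg _))
    (sq_nonneg _)

end RowSums

section FourthMoment

variable {Ω : Type} [MeasurableSpace Ω] {μ : Measure Ω} [IsProbabilityMeasure μ] {T Y : Ω → ℝ}

theorem MemLp.integrable_pow_of_le {p n : ℕ} (h : MemLp T p μ) (hn : n ≤ p) :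
    Integrable (fun ω => T ω ^ n) μ := by
  have h' : MemLp T n μ := h.mono_exponent (by exact_mod_cast hn)
  refine (integrable_norm_iff (h.aestronglyMeasurable.pow n)).1 ?_
  have := h'.integrable_norm_pow'
  simpa [norm_pow] using this

/-- By independence the terms `T³Y` and `TY³` of the binomial expansion factor, and each has a
factor of mean zero. -/
theorem integral_add_pow_four (hT : MemLp T 4 μ) (hY : MemLp Y 4 μ) (h : T ⟂ᵢ[μ] Y)
    (hT0 : ∫ ω, T ω ∂μ = 0) (hY0 : ∫ ω, Y ω ∂μ = 0) :
    ∫ ω, (T ω + Y ω) ^ 4 ∂μ = ∫ ω, T ω ^ 4 ∂μ +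
      6 * ((∫ ω, T ω ^ 2 ∂μ) * ∫ ω, Y ω ^ 2 ∂μ) + ∫ ω, Y ω ^ 4 ∂μ := by
  have iT : ∀ n ≤ 4, Integrable (fun ω => T ω ^ n) μ := fun n hn =>
    MemLp.integrable_pow_of_le (p := 4) hT hn
  have iY : ∀ n ≤ 4, Integrable (fun ω => Y ω ^ n) μ := fun n hn =>
    MemLp.integrable_pow_of_le (p := 4) hY hn
  have hind : ∀ m n : ℕ, (fun ω => T ω ^ m) ⟂ᵢ[μ] (fun ω => Y ω ^ n) := fun m n =>
    h.comp (measurable_id.pow_const m) (measurable_id.pow_const n)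
  have iTY : ∀ m ≤ 4, ∀ n ≤ 4, Integrable (fun ω => T ω ^ m * Y ω ^ n) μ := fun m hm n hn =>
    (hind m n).integrable_mul (iT m hm) (iY n hn)
  have eTY : ∀ m ≤ 4, ∀ n ≤ 4, ∫ ω, T ω ^ m * Y ω ^ n ∂μ =
      (∫ ω, T ω ^ m ∂μ) * ∫ ω, Y ω ^ n ∂μ := fun m hm n hn =>
    (hind m n).integral_fun_mul_eq_mul_integral (iT m hm).aestronglyMeasurable
      (iY n hn).aestronglyMeasurable
  have hT1 : ∫ ω, T ω ^ 1 ∂μ = 0 := by simpa using hT0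
  have hY1 : ∫ ω, Y ω ^ 1 ∂μ = 0 := by simpa using hY0
  have e : ∀ ω, (T ω + Y ω) ^ 4 = T ω ^ 4 + 4 * (T ω ^ 3 * Y ω ^ 1) + 6 * (T ω ^ 2 * Y ω ^ 2) +
      4 * (T ω ^ 1 * Y ω ^ 3) + Y ω ^ 4 := fun ω => by ring
  simp_rw [e]
  have i1 := iT 4 le_rfl
  have i2 := (iTY 3 (by norm_num) 1 (by norm_num)).const_mul 4
  have i3 := (iTY 2 (by norm_num) 2 (by norm_num)).const_mul 6
  have i4 := (iTY 1 (by norm_num) 3 (by norm_num)).const_mul 4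
  rw [integral_add (((i1.fun_add i2).fun_add i3).fun_add i4) (iY 4 le_rfl),
    integral_add ((i1.fun_add i2).fun_add i3) i4, integral_add (i1.fun_add i2) i3,
    integral_add i1 i2]
  simp_rw [integral_const_mul]
  rw [eTY 3 (by norm_num) 1 (by norm_num), eTY 2 (by norm_num) 2 (by norm_num),
    eTY 1 (by norm_num) 3 (by norm_num), hT1, hY1]
  ring

end FourthMoment

section RowSumFourthMoment

variable {E : Type} [MeasurableSpace E] {ν : Measure E} [IsProbabilityMeasure ν] {f : E → ℝ}
  {ι : Type} [Fintype ι]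

theorem indepFun_rowSum (hf : AEMeasurable f ν) (a : ι → ℝ) {s : Finset ι} {r : ι} (hr : r ∉ s) :
    (fun X : ι → E => ∑ i ∈ s, a i * f (X i)) ⟂ᵢ[Measure.pi fun _ : ι => ν]
      (fun X => a r * f (X r)) := by
  have h := iIndepFun_pi (μ := fun _ : ι => ν) (X := fun r x => a r * f x)
    fun r => hf.const_mul (a r)
  have h2 := h.indepFun_finsetSum_of_notMem₀ (fun i =>
    (hf.const_mul (a i)).comp_quasiMeasurePreserving (Measure.quasiMeasurePreserving_eval _ i)) hr
  convert h2 using 1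
  funext X
  simp

/-- The constant 9 survives adding a row because `9v² + 6va² + 9a⁴ ≤ 9(v + a²)²`. It equals `3²`,
the fourth moment of a product of two independent standard normals, which is the `f` of an
off-diagonal sketch entry. -/
theorem integral_rowSum_sq_and_pow_four_le (hf : MemLp f 4 ν) (h1 : ∫ x, f x ∂ν = 0)
    (h2 : ∫ x, f x ^ 2 ∂ν = 1) (h4 : ∫ x, f x ^ 4 ∂ν ≤ 9) (a : ι → ℝ) (s : Finset ι) :
    ∫ X, (∑ r ∈ s, a r * f (X r)) ^ 2 ∂(Measure.pi fun _ : ι => ν) = ∑ r ∈ s, a r ^ 2 ∧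
    ∫ X, (∑ r ∈ s, a r * f (X r)) ^ 4 ∂(Measure.pi fun _ : ι => ν) ≤
      9 * (∑ r ∈ s, a r ^ 2) ^ 2 := by
  classical
  induction s using Finset.induction_on with
  | empty => simp
  | insert r s hr ih =>
    have hT : MemLp (fun X : ι → E => ∑ i ∈ s, a i * f (X i)) 4 (Measure.pi fun _ : ι => ν) :=
      memLp_rowSum hf a s
    have hY : MemLp (fun X : ι → E => a r * f (X r)) 4 (Measure.pi fun _ : ι => ν) := by
      simpa using memLp_rowSum hf a {r}
    have hind := indepFun_rowSum (ν := ν) hf.aestronglyMeasurable.aemeasurable a hr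
    have hfi : Integrable f ν := hf.integrable (by norm_num)
    have hT0 : ∫ X, ∑ i ∈ s, a i * f (X i) ∂(Measure.pi fun _ : ι => ν) = 0 := by
      rw [integral_rowSum hfi, h1, mul_zero]
    have hY0 : ∫ X, a r * f (X r) ∂(Measure.pi fun _ : ι => ν) = 0 := by
      have := integral_rowSum hfi a {r}
      simpa [h1] using this
    have hYn : ∀ n : ℕ, ∫ X, (a r * f (X r)) ^ n ∂(Measure.pi fun _ : ι => ν) =
        a r ^ n * ∫ x, f x ^ n ∂ν := by
      intro n
      simp_rw [mul_pow]
      rw [integral_const_mul, integral_comp_eval_pi (fun x => f x ^ n)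
        (hf.aestronglyMeasurable.pow n)]
    simp_rw [Finset.sum_insert hr, add_comm (a r * f _)]
    constructor
    · have hT2 := hT.mono_exponent (p := 2) (by norm_num)
      have hY2 := hY.mono_exponent (p := 2) (by norm_num)
      have hv := hind.variance_fun_add hT2 hY2
      have hadd : AEMeasurable (fun X : ι → E => ∑ i ∈ s, a i * f (X i) + a r * f (X r))
          (Measure.pi fun _ : ι => ν) :=
        hT.aestronglyMeasurable.aemeasurable.add hY.aestronglyMeasurable.aemeasurable
      rw [variance_of_integral_eq_zero hadd,
        variance_of_integral_eq_zero hT.aestronglyMeasurable.aemeasurable hT0,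
        variance_of_integral_eq_zero hY.aestronglyMeasurable.aemeasurable hY0, ih.1, hYn, h2] at hv
      · rw [hv]; ring
      · rw [integral_add (hT.integrable (by norm_num)) (hY.integrable (by norm_num)), hT0, hY0,
          add_zero]
    · rw [integral_add_pow_four hT hY hind hT0 hY0, ih.1, hYn, hYn, h2]
      have h4' : 0 ≤ a r ^ 4 := by positivity
      have hs : 0 ≤ ∑ i ∈ s, a i ^ 2 := Finset.sum_nonneg fun _ _ => sq_nonneg _
      nlinarith [ih.2, mul_le_mul_of_nonneg_left h4 h4', mul_nonneg hs (sq_nonneg (a r))]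

end RowSumFourthMoment

/-! ### Moments of products of two entries and of the squared norm of a Gaussian row. -/

section Entries

theorem memLp_sq_gaussianReal (v : ℝ≥0) : MemLp (fun x : ℝ => x ^ 2) 2 (gaussianReal 0 v) := by
  have := (memLp_id_gaussianReal (μ := 0) (v := v) 4).integrable_norm_pow (p := 4) (by norm_num)
  rw [memLp_two_iff_integrable_sq (by fun_prop)]
  refine this.congr (Filter.Eventually.of_forall fun g => ?_)
  simp only [Real.norm_eq_abs, id]
  rw [← pow_mul, Even.pow_abs (by decide)]

variable {κ : Type} [Fintype κ]

theorem memLp_apply_stdPi (i : κ) (p : ℝ≥0) : MemLp (fun x : κ → ℝ => x i) p (stdPi κ) :=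
  (memLp_id_gaussianReal p).comp_measurePreserving
    (measurePreserving_eval (fun _ : κ => gaussianReal 0 1) i)

theorem memLp_apply_mul_apply_stdPi (i j : κ) :
    MemLp (fun x : κ → ℝ => x i * x j) 4 (stdPi κ) := by
  have : ENNReal.HolderTriple 8 8 4 := by
    constructor
    rw [← ENNReal.toReal_eq_toReal_iff' (by simp) (by simp), ENNReal.toReal_add (by simp) (by simp)]
    simp; norm_num
  exact (memLp_apply_stdPi j 8).mul' (p := 8) (q := 8) (memLp_apply_stdPi i 8)

theorem integral_apply_pow_stdPi (i : κ) (n : ℕ) :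
    ∫ x : κ → ℝ, x i ^ n ∂(stdPi κ) = ∫ x, x ^ n ∂(gaussianReal 0 1) :=
  integral_comp_eval_pi (fun x => x ^ n) (by fun_prop) i

theorem integral_apply_mul_apply_pow_stdPi {i j : κ} (hij : i ≠ j) (n : ℕ) :
    ∫ x : κ → ℝ, (x i * x j) ^ n ∂(stdPi κ) = (∫ x, x ^ n ∂(gaussianReal 0 1)) ^ 2 := by
  have h := (iIndepFun_pi (μ := fun _ : κ => gaussianReal 0 1) (X := fun _ x => x ^ n)
    (fun _ => by fun_prop)).indepFun hij
  simp_rw [mul_pow]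
  rw [h.integral_fun_mul_eq_mul_integral ((measurable_pi_apply i).pow_const n).aestronglyMeasurable
      ((measurable_pi_apply j).pow_const n).aestronglyMeasurable, integral_apply_pow_stdPi,
    integral_apply_pow_stdPi, sq]

theorem integral_apply_mul_apply_stdPi [DecidableEq κ] (i j : κ) :
    ∫ x : κ → ℝ, x i * x j ∂(stdPi κ) = if i = j then 1 else 0 := by
  split_ifs with h
  · subst h
    simp_rw [← sq]
    rw [integral_apply_pow_stdPi, integral_sq_gaussianReal]
    simp
  · have := integral_apply_mul_apply_pow_stdPi h 1
    simpa using this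

theorem variance_apply_mul_apply_stdPi_le (i j : κ) :
    Var[fun x : κ → ℝ => x i * x j; stdPi κ] ≤ 3 := by
  refine (variance_le_expectation_sq
    (memLp_apply_mul_apply_stdPi i j).aestronglyMeasurable).trans ?_
  simp only [Pi.pow_apply]
  rcases eq_or_ne i j with rfl | h
  · have : ∀ x : κ → ℝ, (x i * x i) ^ 2 = x i ^ 4 := fun x => by ring
    simp_rw [this]
    rw [integral_apply_pow_stdPi, integral_pow_four_gaussianReal]
    simp
  · rw [integral_apply_mul_apply_pow_stdPi h, integral_sq_gaussianReal]
    norm_num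

theorem memLp_norm_sq_stdPi : MemLp (fun x : κ → ℝ => ∑ j, x j ^ 2) 2 (stdPi κ) := by
  have := memLp_rowSum (memLp_sq_gaussianReal 1) (fun _ : κ => 1) Finset.univ
  simpa using this

theorem integral_norm_sq_stdPi :
    ∫ x : κ → ℝ, ∑ j, x j ^ 2 ∂(stdPi κ) = Fintype.card κ := by
  have h : Integrable (fun x : ℝ => x ^ 2) (gaussianReal 0 1) :=
    MemLp.integrable_pow_of_le (p := 2) (memLp_id_gaussianReal 2) le_rfl
  have := integral_rowSum h (fun _ : κ => 1) Finset.univ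
  simpa [integral_sq_gaussianReal] using this

theorem variance_norm_sq_stdPi :
    Var[fun x : κ → ℝ => ∑ j, x j ^ 2; stdPi κ] = 2 * Fintype.card κ := by
  have hm := memLp_sq_gaussianReal 1
  have hv : Var[fun x : ℝ => x ^ 2; gaussianReal 0 1] = 2 := by
    rw [variance_eq_sub hm]
    simp only [Pi.pow_apply, ← pow_mul]
    rw [show (2 * 2 : ℕ) = 4 from rfl, integral_pow_four_gaussianReal, integral_sq_gaussianReal]
    norm_num
  have := variance_rowSum hm (fun _ : κ => 1)
  simpa [hv] using this

end Entries

/-! ### Variational characterization of the smallest eigenvalue. -/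

section LambdaMin

variable {ι : Type} [Fintype ι] [DecidableEq ι] {M : Matrix ι ι ℝ}

theorem lambdaMin_eq_iInf (hM : M.IsHermitian) : lambdaMin M = ⨅ i, hM.eigenvalues i := by
  rw [lambdaMin, hM.spectrum_real_eq_range_eigenvalues, iInf]

theorem le_lambdaMin_of_unit [Nonempty ι] (hM : M.IsSymm) {c : ℝ}
    (h : ∀ x : ι → ℝ, x ⬝ᵥ x = 1 → c ≤ x ⬝ᵥ M.mulVec x) : c ≤ lambdaMin M := by
  have hH : M.IsHermitian := by rwa [Matrix.isHermitian_iff_isSymm]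
  rw [lambdaMin_eq_iInf hH, le_ciInf_iff (Set.finite_range _).bddBelow]
  intro i
  have h2 : (hH.eigenvectorBasis i : ι → ℝ) ⬝ᵥ (hH.eigenvectorBasis i : ι → ℝ) = 1 := by
    have h3 := EuclideanSpace.real_norm_sq_eq (hH.eigenvectorBasis i)
    rw [hH.eigenvectorBasis.orthonormal.1 i] at h3
    simp only [dotProduct, ← sq]
    linarith
  have h1 := h (hH.eigenvectorBasis i) h2
  rw [hH.mulVec_eigenvectorBasis, dotProduct_smul, smul_eq_mul, h2] at h1
  linarith

/-- Shifting by `c` moves the spectrum to the nonnegative half-line, so `M - c` is PSD. For an empty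
index type `lambdaMin` is `sInf ∅ = 0`, and the equivalence fails for `c > 0`. -/
theorem le_lambdaMin_iff [Nonempty ι] (hM : M.IsSymm) (c : ℝ) :
    c ≤ lambdaMin M ↔ ∀ x : ι → ℝ, c * (x ⬝ᵥ x) ≤ x ⬝ᵥ M.mulVec x := by
  have hH : M.IsHermitian := by rwa [Matrix.isHermitian_iff_isSymm]
  rw [lambdaMin_eq_iInf hH, le_ciInf_iff (Set.finite_range _).bddBelow]
  constructor
  · intro h x
    have hS : (M - c • (1 : Matrix ι ι ℝ)).IsHermitian :=
      hH.sub (Matrix.isHermitian_one.smul (IsSelfAdjoint.all c))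
    have : (M - c • (1 : Matrix ι ι ℝ)).PosSemidef := by
      rw [Matrix.posSemidef_iff_isHermitian_and_spectrum_nonneg]
      refine ⟨hS, fun μ hμ => ?_⟩
      have h1 : μ + c ∈ spectrum ℝ M := by
        rw [spectrum.mem_iff] at hμ ⊢
        convert hμ using 2
        rw [map_add, Algebra.algebraMap_eq_smul_one c]
        abel
      rw [hH.spectrum_real_eq_range_eigenvalues] at h1
      obtain ⟨i, hi⟩ := h1
      have := h i
      show 0 ≤ μ
      linarith
    have h2 := this.dotProduct_mulVec_nonneg x
    simp only [star_trivial, Matrix.sub_mulVec, dotProduct_sub, Matrix.smul_mulVec,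
      Matrix.one_mulVec, dotProduct_smul, smul_eq_mul] at h2
    linarith
  · intro h
    rw [← le_ciInf_iff (Set.finite_range _).bddBelow, ← lambdaMin_eq_iInf hH]
    exact le_lambdaMin_of_unit hM fun x hx => by simpa [hx] using h x

theorem lambdaMin_mul_le [Nonempty ι] (hM : M.IsSymm) (x : ι → ℝ) :
    lambdaMin M * (x ⬝ᵥ x) ≤ x ⬝ᵥ M.mulVec x :=
  (le_lambdaMin_iff hM _).1 le_rfl x

theorem exists_eigenvalue_eq_lambdaMin [Nonempty ι] (hM : M.IsHermitian) :
    ∃ i, hM.eigenvalues i = lambdaMin M := by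
  rw [lambdaMin_eq_iInf hM]
  exact exists_eq_ciInf_of_finite

end LambdaMin

theorem bilinearSketch_isSymm {d : ℕ} {κ : Type} {A : Matrix (Fin d) (Fin d) ℝ} (hA : A.IsSymm)
    (G : Matrix (Fin d) κ ℝ) : (bilinearSketch A G).IsSymm := by
  unfold bilinearSketch Matrix.IsSymm
  rw [Matrix.transpose_mul, Matrix.transpose_mul, Matrix.transpose_transpose, hA.eq,
    Matrix.mul_assoc]

theorem bilinearSketch_diagonal_apply {d : ℕ} {κ : Type} (a : Fin d → ℝ)
    (G : Matrix (Fin d) κ ℝ) (i j : κ) :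
    bilinearSketch (Matrix.diagonal a) G i j = ∑ r, a r * (G r i * G r j) := by
  unfold bilinearSketch
  rw [Matrix.mul_apply]
  refine Finset.sum_congr rfl fun r _ => ?_
  rw [Matrix.mul_diagonal, Matrix.transpose_apply]
  ring

theorem dotProduct_bilinearSketch_diagonal {d : ℕ} {κ : Type} [Fintype κ] (a : Fin d → ℝ)
    (G : Matrix (Fin d) κ ℝ) (x : κ → ℝ) :
    x ⬝ᵥ (bilinearSketch (Matrix.diagonal a) G).mulVec x = ∑ r, a r * (G r ⬝ᵥ x) ^ 2 := by
  simp only [dotProduct, Matrix.mulVec, bilinearSketch_diagonal_apply, Finset.mul_sum,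
    Finset.sum_mul, sq]
  rw [Finset.sum_comm' (t' := Finset.univ) (s' := fun _ => Finset.univ) (by simp)]
  simp_rw [Finset.sum_comm (s := (Finset.univ : Finset κ)) (t := (Finset.univ : Finset (Fin d)))]
  refine Finset.sum_congr rfl fun r _ => ?_
  refine Finset.sum_congr rfl fun i _ => Finset.sum_congr rfl fun j _ => ?_
  ring

theorem measurable_entry {ι κ : Type} (i : ι) (j : κ) :
    Measurable fun X : Matrix ι κ ℝ => X i j :=
  (measurable_pi_apply j).comp (measurable_pi_apply i)

/-! ### Rotation invariance and reduction to diagonal matrices. -/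

section Invariance

variable {d : ℕ} {κ : Type} [Fintype κ]

/-- Transposing a matrix of independent, identically distributed entries. -/
theorem measurePreserving_swap (ι κ : Type) [Fintype ι] [Fintype κ] (ν : Measure ℝ)
    [IsProbabilityMeasure ν] :
    MeasurePreserving (fun (X : ι → κ → ℝ) j i => X i j)
      (Measure.pi fun _ : ι => Measure.pi fun _ : κ => ν)
      (Measure.pi fun _ : κ => Measure.pi fun _ : ι => ν) := by
  -- Uncurry to the product law on `ι × κ`, exchange the two indices, and curry again.
  have h1 := Measure.infinitePi_map_curry_symm (fun (_ : ι) (_ : κ) => ν)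
  have h2 := Measure.infinitePi_map_curry (fun (_ : κ) (_ : ι) => ν)
  simp only [Measure.infinitePi_eq_pi] at h1 h2
  have e := measurePreserving_piCongrLeft (fun _ : κ × ι => ν) (Equiv.prodComm ι κ)
  have m1 : MeasurePreserving (MeasurableEquiv.curry ι κ ℝ).symm
      (Measure.pi fun _ : ι => Measure.pi fun _ : κ => ν) (Measure.pi fun _ : ι × κ => ν) :=
    ⟨MeasurableEquiv.measurable _, h1⟩
  have m2 : MeasurePreserving (MeasurableEquiv.curry κ ι ℝ) (Measure.pi fun _ : κ × ι => ν)
      (Measure.pi fun _ : κ => Measure.pi fun _ : ι => ν) :=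
    ⟨MeasurableEquiv.measurable _, h2⟩
  have m := m2.comp (e.comp m1)
  convert m using 1
  funext X j i
  exact (Equiv.piCongrLeft_apply_apply (fun _ : κ × ι => ℝ) (Equiv.prodComm ι κ)
    (fun p => X p.1 p.2) (i, j)).symm

/-- The law of the matrix of expansions of the columns of a Gaussian matrix in an orthonormal
basis is again Gaussian. -/
theorem measurePreserving_unitary_mul {U : Matrix (Fin d) (Fin d) ℝ}
    (b : OrthonormalBasis (Fin d) ℝ (EuclideanSpace ℝ (Fin d))) (hU : ∀ i r, U r i = b i r) :
    MeasurePreserving (fun X : Matrix (Fin d) κ ℝ => U * X) (gaussianMatrix d κ)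
      (gaussianMatrix d κ) := by
  have h1 : MeasurePreserving (fun x : Fin d → ℝ => U.mulVec x) (stdPi (Fin d))
      (stdPi (Fin d)) := by
    refine ⟨by unfold Matrix.mulVec dotProduct; fun_prop, ?_⟩
    have hb := stdGaussian_eq_map_pi_orthonormalBasis b
    rw [← map_pi_eq_stdGaussian] at hb
    have hb2 := congrArg (Measure.map (WithLp.ofLp)) hb
    rw [Measure.map_map (by fun_prop) (by fun_prop), Measure.map_map (by fun_prop) (by fun_prop)]
      at hb2
    have e1 : (WithLp.ofLp ∘ (WithLp.toLp 2) : (Fin d → ℝ) → (Fin d → ℝ)) = id := rfl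
    rw [e1, Measure.map_id] at hb2
    refine Eq.trans ?_ hb2.symm
    congr 1
    funext x r
    simp [Matrix.mulVec, dotProduct, hU, mul_comm]
  have h2 := measurePreserving_pi (fun _ : κ => stdPi (Fin d)) (fun _ : κ => stdPi (Fin d))
    (fun _ => h1)
  -- Left multiplication acts on columns, whereas `gaussianMatrix` is a product over rows, so the
  -- rotation is conjugated by transposition.
  have h3 := (measurePreserving_swap κ (Fin d) (gaussianReal 0 1)).comp
    (h2.comp (measurePreserving_swap (Fin d) κ (gaussianReal 0 1)))
  exact h3

theorem frobNorm_sq {ι κ : Type} [Fintype ι] [Fintype κ] (M : Matrix ι κ ℝ) :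
    frobNorm M ^ 2 = ∑ i, ∑ j, M i j ^ 2 :=
  Real.sq_sqrt (Finset.sum_nonneg fun _ _ => Finset.sum_nonneg fun _ _ => sq_nonneg _)

theorem frobNorm_nonneg {ι κ : Type} [Fintype ι] [Fintype κ] (M : Matrix ι κ ℝ) :
    0 ≤ frobNorm M := Real.sqrt_nonneg _

theorem frobNorm_sq_eq_trace {ι κ : Type} [Fintype ι] [Fintype κ] (M : Matrix ι κ ℝ) :
    frobNorm M ^ 2 = (M * M.transpose).trace := by
  rw [frobNorm_sq]
  simp [Matrix.trace, Matrix.mul_apply, sq]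

theorem frobNorm_pos {ι κ : Type} [Fintype ι] [Fintype κ] {M : Matrix ι κ ℝ} (hM : M ≠ 0) :
    0 < frobNorm M := by
  by_contra h
  have h0 : frobNorm M = 0 := le_antisymm (not_lt.1 h) (frobNorm_nonneg M)
  apply hM
  have h1 := frobNorm_sq M
  rw [h0, zero_pow two_ne_zero, eq_comm] at h1
  ext i j
  have h2 := (Finset.sum_eq_zero_iff_of_nonneg fun i _ =>
    Finset.sum_nonneg fun j _ => sq_nonneg (M i j)).1 h1 i (Finset.mem_univ _)
  have h3 := (Finset.sum_eq_zero_iff_of_nonneg fun j _ => sq_nonneg (M i j)).1 h2 j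
    (Finset.mem_univ _)
  simpa using h3

/-- Rotation invariance: for the purpose of bounding the probability of an event which depends on
the sketch of `A` only, the matrix `A` may be taken to be diagonal. -/
theorem exists_diagonal_sketch {A : Matrix (Fin d) (Fin d) ℝ} (hA : A.IsSymm) :
    ∃ a : Fin d → ℝ, A.trace = ∑ r, a r ∧ frobNorm A ^ 2 = ∑ r, a r ^ 2 ∧
      (A.PosSemidef → ∀ r, 0 ≤ a r) ∧ (0 < d → ∃ r, a r = lambdaMin A) ∧
      ∀ (κ : Type) [Fintype κ] (B : Set (Matrix κ κ ℝ)),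
        (gaussianMatrix d κ).real {G | bilinearSketch A G ∈ B} ≤
          (gaussianMatrix d κ).real {Y | bilinearSketch (Matrix.diagonal a) Y ∈ B} := by
  have hH : A.IsHermitian := by rwa [Matrix.isHermitian_iff_isSymm]
  set U : Matrix (Fin d) (Fin d) ℝ := hH.eigenvectorUnitary.1 with hU
  have hUU : U * U.transpose = 1 := by
    have := Matrix.mem_unitaryGroup_iff.1 hH.eigenvectorUnitary.2
    rwa [Matrix.star_eq_conjTranspose, Matrix.conjTranspose_eq_transpose_of_trivial] at this
  have hUU' : U.transpose * U = 1 := by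
    have := Matrix.mem_unitaryGroup_iff'.1 hH.eigenvectorUnitary.2
    rwa [Matrix.star_eq_conjTranspose, Matrix.conjTranspose_eq_transpose_of_trivial] at this
  have hspec : A = U * Matrix.diagonal hH.eigenvalues * U.transpose := by
    have := hH.spectral_theorem
    rw [Unitary.conjStarAlgAut_apply, Matrix.star_eq_conjTranspose,
      Matrix.conjTranspose_eq_transpose_of_trivial] at this
    exact this
  refine ⟨hH.eigenvalues, ?_, ?_, ?_, ?_, ?_⟩
  · simpa using hH.trace_eq_sum_eigenvalues
  · rw [frobNorm_sq_eq_trace, hA.eq]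
    have : A * A = U * (Matrix.diagonal hH.eigenvalues * Matrix.diagonal hH.eigenvalues) *
        U.transpose := by
      conv_lhs => rw [hspec]
      calc _ = U * Matrix.diagonal hH.eigenvalues * (U.transpose * U) *
          Matrix.diagonal hH.eigenvalues * U.transpose := by simp only [Matrix.mul_assoc]
        _ = _ := by rw [hUU', Matrix.mul_one]; simp only [Matrix.mul_assoc]
    rw [this, Matrix.trace_mul_comm, ← Matrix.mul_assoc, hUU', Matrix.one_mul,
      Matrix.diagonal_mul_diagonal, Matrix.trace_diagonal]
    simp only [sq]
  · exact fun h r => hH.posSemidef_iff_eigenvalues_nonneg.1 h r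
  · intro hd
    have : Nonempty (Fin d) := ⟨⟨0, hd⟩⟩
    exact exists_eigenvalue_eq_lambdaMin hH
  · intro κ _ B
    have hm : MeasurePreserving (fun X : Matrix (Fin d) κ ℝ => U * X) (gaussianMatrix d κ)
        (gaussianMatrix d κ) :=
      measurePreserving_unitary_mul hH.eigenvectorBasis fun i r => rfl
    have hmeas : Measurable fun X : Matrix (Fin d) κ ℝ => U.transpose * X := by
      refine measurable_pi_lambda _ fun i => measurable_pi_lambda _ fun j => ?_
      simp only [Matrix.mul_apply]
      exact Finset.measurable_sum _ fun r _ => (measurable_entry r j).const_mul _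
    -- Multiplication by `Uᵀ` inverts the measure-preserving multiplication by `U`.
    have hm' : MeasurePreserving (fun X : Matrix (Fin d) κ ℝ => U.transpose * X)
        (gaussianMatrix d κ) (gaussianMatrix d κ) := by
      refine ⟨hmeas, ?_⟩
      conv_lhs => rw [← hm.map_eq]
      rw [Measure.map_map hmeas hm.measurable]
      have : ((fun X : Matrix (Fin d) κ ℝ => U.transpose * X) ∘ fun X => U * X) = id := by
        funext X
        simp [← Matrix.mul_assoc, hUU']
      rw [this, Measure.map_id]
    have hpre : {G : Matrix (Fin d) κ ℝ | bilinearSketch A G ∈ B} =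
        (fun X : Matrix (Fin d) κ ℝ => U.transpose * X) ⁻¹'
          {Y | bilinearSketch (Matrix.diagonal hH.eigenvalues) Y ∈ B} := by
      ext G
      have : bilinearSketch A G =
          bilinearSketch (Matrix.diagonal hH.eigenvalues) (U.transpose * G) := by
        unfold bilinearSketch
        conv_lhs => rw [hspec]
        rw [Matrix.transpose_mul, Matrix.transpose_transpose]
        simp only [Matrix.mul_assoc]
      change bilinearSketch A G ∈ B ↔ bilinearSketch _ _ ∈ B
      rw [this]
    rw [hpre]
    -- For an arbitrary set, measure preservation yields this inequality; only upper bounds are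
    -- needed, so `B` need not be measurable.
    exact ENNReal.toReal_mono (measure_ne_top _ _) (hm'.measure_preimage_le _)

end Invariance

/-! ### Estimating the trace and the Frobenius norm. -/

/-- Subadditivity suffices, so neither event has to be measurable. -/
theorem one_sub_le_measureReal {Ω : Type} [MeasurableSpace Ω] {μ : Measure Ω}
    [IsProbabilityMeasure μ] {good bad : Set Ω} {δ p : ℝ}
    (hb : μ.real bad ≤ δ) (hp : p ≤ 1 - δ) (h : ∀ ω, ω ∉ bad → ω ∈ good) : p ≤ μ.real good := by
  have h1 : (1 : ℝ) ≤ μ.real (good ∪ bad) := by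
    rw [show good ∪ bad = Set.univ from Set.eq_univ_of_forall fun ω => by
      by_cases hω : ω ∈ bad
      · exact Or.inr hω
      · exact Or.inl (h ω hω)]
    simp
  linarith [measureReal_union_le (μ := μ) good bad]

/-- The estimate of the trace: the average of the diagonal entries of the sketch. -/
noncomputable def traceEstimate (m : ℕ) (S : Matrix (Fin m) (Fin m) ℝ) : ℝ :=
  (1 / m : ℝ) * ∑ j, S j j

/-- The estimate of the Frobenius norm: the root mean square of `n` entries of the sketch which
depend on disjoint pairs of columns. -/
noncomputable def frobEstimate (n : ℕ) (S : Matrix (Fin (n + n)) (Fin (n + n)) ℝ) : ℝ :=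
  Real.sqrt ((1 / n : ℝ) * ∑ i : Fin n, S (Fin.castAdd n i) (Fin.natAdd n i) ^ 2)

theorem measurable_traceEstimate (m : ℕ) : Measurable (traceEstimate m) :=
  (Finset.measurable_sum _ fun j _ => measurable_entry j j).const_mul _

theorem measurable_frobEstimate (n : ℕ) : Measurable (frobEstimate n) :=
  ((Finset.measurable_sum _ fun _ _ => (measurable_entry _ _).pow_const 2).const_mul _).sqrt

theorem bilinearSketch_zero {d : ℕ} {κ : Type} (G : Matrix (Fin d) κ ℝ) :
    bilinearSketch (0 : Matrix (Fin d) (Fin d) ℝ) G = 0 := by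
  unfold bilinearSketch
  rw [Matrix.mul_zero, Matrix.zero_mul]

theorem frobNorm_zero {ι κ : Type} [Fintype ι] [Fintype κ] :
    frobNorm (0 : Matrix ι κ ℝ) = 0 := by
  simp [frobNorm]

/-- For diagonal `A` the estimate is `∑ a_r ‖H_r‖² / m`, of mean `Tr(A)` and variance `2F²/m`, so
Chebyshev at distance `F` costs `2/m`. The case `A = 0` is separate because Chebyshev needs a
positive distance. -/
theorem real_traceEstimate_deviation_le {d m : ℕ} (hm : 200 ≤ m) {A : Matrix (Fin d) (Fin d) ℝ}
    (hA : A.IsSymm) :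
    (gaussianMatrix d (Fin m)).real
      {H | frobNorm A < |traceEstimate m (bilinearSketch A H) - A.trace|} ≤ 0.01 := by
  rcases eq_or_ne A 0 with rfl | h0
  · simp only [bilinearSketch_zero, frobNorm_zero, Matrix.trace_zero, traceEstimate,
      Matrix.zero_apply, Finset.sum_const_zero, mul_zero, sub_zero, abs_zero, lt_self_iff_false]
    rw [show {_x : Matrix (Fin d) (Fin m) ℝ | False} = ∅ from rfl, measureReal_empty]
    norm_num
  have hF := frobNorm_pos h0
  obtain ⟨a, htr, hfr, -, -, hB⟩ := exists_diagonal_sketch hA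
  refine (hB (Fin m) {S | frobNorm A < |traceEstimate m S - A.trace|}).trans ?_
  have hm0 : (0 : ℝ) < m := by exact_mod_cast (by omega : 0 < m)
  have hf := (memLp_norm_sq_stdPi (κ := Fin m)).const_mul (1 / m : ℝ)
  have h := real_rowSum_deviation_le hf a hF
  rw [variance_const_mul, variance_norm_sq_stdPi, integral_const_mul, integral_norm_sq_stdPi,
    ← hfr, ← htr, Fintype.card_fin, one_div_mul_cancel hm0.ne', mul_one,
    mul_div_cancel_right₀ _ (pow_pos hF 2).ne'] at h
  refine (measureReal_mono ?_ (measure_ne_top _ _)).trans (h.trans ?_)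
  · intro Y hY
    change frobNorm A ≤ _
    refine le_of_lt (lt_of_lt_of_eq hY ?_)
    congr 2
    simp only [traceEstimate, bilinearSketch_diagonal_apply]
    rw [Finset.sum_comm, Finset.mul_sum]
    refine Finset.sum_congr rfl fun r _ => ?_
    simp only [Finset.mul_sum]
    exact Finset.sum_congr rfl fun j _ => by ring
  · have : (200 : ℝ) ≤ m := by exact_mod_cast hm
    rw [show (1 / m : ℝ) ^ 2 * (2 * m) = 2 / m by field_simp, div_le_iff₀ hm0]
    linarith

theorem iIndepFun_col_gaussianMatrix (d : ℕ) (κ : Type) [Fintype κ] :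
    iIndepFun (fun (j : κ) (X : Matrix (Fin d) κ ℝ) (r : Fin d) => X r j)
      (gaussianMatrix d κ) := by
  have hs := measurePreserving_swap (Fin d) κ (gaussianReal 0 1)
  have hmeas : ∀ j : κ, Measurable fun (X : Matrix (Fin d) κ ℝ) (r : Fin d) => X r j :=
    fun j => measurable_pi_lambda _ fun r => measurable_entry r j
  rw [iIndepFun_iff_map_fun_eq_pi_map fun j => (hmeas j).aemeasurable]
  have hcol : ∀ j : κ, (gaussianMatrix d κ).map
      (fun (X : Matrix (Fin d) κ ℝ) (r : Fin d) => X r j) = stdPi (Fin d) := fun j =>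
    ((measurePreserving_eval (fun _ : κ => stdPi (Fin d)) j).comp hs).map_eq
  simp_rw [hcol]
  exact hs.map_eq

/-- An entry built from two different columns has second moment `F²` and fourth moment at most
`9F⁴`. Disjoint pairs of columns give independent entries, so their squares average out. -/
theorem real_frobEstimate_deviation_le {d n : ℕ} (hn : 1600 ≤ n) {A : Matrix (Fin d) (Fin d) ℝ}
    (hA : A.IsSymm) :
    (gaussianMatrix d (Fin (n + n))).real
      {H | ¬ (frobNorm A / 2 ≤ frobEstimate n (bilinearSketch A H) ∧
        frobEstimate n (bilinearSketch A H) ≤ 2 * frobNorm A)} ≤ 0.01 := by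
  rcases eq_or_ne A 0 with rfl | h0
  · simp only [bilinearSketch_zero, frobNorm_zero, frobEstimate, Matrix.zero_apply]
    norm_num
  have hF := frobNorm_pos h0
  obtain ⟨a, htr, hfr, -, -, hB⟩ := exists_diagonal_sketch hA
  refine (hB (Fin (n + n)) {S | ¬ (frobNorm A / 2 ≤ frobEstimate n S ∧
        frobEstimate n S ≤ 2 * frobNorm A)}).trans ?_
  have hn0 : (0 : ℝ) < n := by exact_mod_cast (by omega : 0 < n)
  set μ := gaussianMatrix d (Fin (n + n)) with hμ
  let Q : Fin n → Matrix (Fin d) (Fin (n + n)) ℝ → ℝ := fun i X =>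
    ∑ r, a r * (X r (Fin.castAdd n i) * X r (Fin.natAdd n i))
  have hne : ∀ i j : Fin n, Fin.castAdd n i ≠ Fin.natAdd n j := fun i j h => by
    have := congrArg Fin.val h
    simp at this
    omega
  have hQ4 : ∀ i, MemLp (Q i) 4 μ := fun i =>
    memLp_rowSum (memLp_apply_mul_apply_stdPi (Fin.castAdd n i) (Fin.natAdd n i)) a Finset.univ
  have hmom : ∀ i, ∫ X, Q i X ^ 2 ∂μ = frobNorm A ^ 2 ∧
      ∫ X, Q i X ^ 4 ∂μ ≤ 9 * (frobNorm A ^ 2) ^ 2 := by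
    intro i
    rw [hfr]
    refine integral_rowSum_sq_and_pow_four_le (memLp_apply_mul_apply_stdPi (Fin.castAdd n i)
      (Fin.natAdd n i)) ?_ ?_ ?_ a Finset.univ
    · rw [integral_apply_mul_apply_stdPi, if_neg (hne i i)]
    · rw [integral_apply_mul_apply_pow_stdPi (hne i i), integral_sq_gaussianReal]
      simp
    · rw [integral_apply_mul_apply_pow_stdPi (hne i i), integral_pow_four_gaussianReal]
      norm_num
  have hQ2 : ∀ i, MemLp (fun X => Q i X ^ 2) 2 μ := by
    intro i
    have hm : AEStronglyMeasurable (fun X => Q i X ^ 2) μ := (hQ4 i).aestronglyMeasurable.pow 2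
    rw [memLp_two_iff_integrable_sq hm]
    simp_rw [← pow_mul]
    exact MemLp.integrable_pow_of_le (p := 4) (hQ4 i) le_rfl
  have hind : ∀ i j, i ≠ j → (fun X => Q i X ^ 2) ⟂ᵢ[μ] (fun X => Q j X ^ 2) := by
    intro i j hij
    have h := (iIndepFun_col_gaussianMatrix d (Fin (n + n))).indepFun_prodMk_prodMk
      (fun j => measurable_pi_lambda _ fun r => measurable_entry r j)
      (Fin.castAdd n i) (Fin.natAdd n i) (Fin.castAdd n j) (Fin.natAdd n j)
      (by simpa using hij) (hne i j) (hne j i).symm (by simpa using hij)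
    have hφ : Measurable fun p : (Fin d → ℝ) × (Fin d → ℝ) =>
        (∑ r, a r * (p.1 r * p.2 r)) ^ 2 := by fun_prop
    exact h.comp hφ hφ
  have hZ2 : MemLp (∑ i, fun X => Q i X ^ 2) 2 μ := memLp_finsetSum' _ fun i _ => hQ2 i
  have hvar : Var[∑ i, fun X => Q i X ^ 2; μ] ≤ n * (9 * (frobNorm A ^ 2) ^ 2) := by
    rw [IndepFun.variance_sum (fun i _ => hQ2 i) fun i _ j _ hij => hind i j hij]
    refine (Finset.sum_le_card_nsmul _ _ (9 * (frobNorm A ^ 2) ^ 2) fun i _ => ?_).trans ?_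
    · refine (variance_le_expectation_sq (hQ2 i).aestronglyMeasurable).trans ?_
      simp only [Pi.pow_apply, ← pow_mul]
      simpa [← pow_mul] using (hmom i).2
    · simp
  have hmean : ∫ X, (∑ i, fun X => Q i X ^ 2) X ∂μ = n * frobNorm A ^ 2 := by
    simp only [Finset.sum_apply]
    rw [integral_finsetSum _ fun i _ => (hQ2 i).integrable (by norm_num)]
    simp [hmom]
  -- A relative error of 3/4 in the mean square keeps it above `F²/4` and below `4F²`; the failure
  -- probability is at most `9 / ((9/16) n) = 16/n`.
  have ht : (0 : ℝ) < n * (3 / 4 * frobNorm A ^ 2) := by positivity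
  have h := meas_ge_le_variance_div_sq hZ2 ht
  rw [hmean] at h
  have h' := ENNReal.toReal_le_of_le_ofReal
    (div_nonneg (variance_nonneg _ _) (sq_nonneg _)) h
  refine (measureReal_mono ?_ (measure_ne_top _ _)).trans (h'.trans ?_)
  · intro Y hY
    by_contra hlt
    apply hY
    rw [Set.mem_ofPred_eq, not_le, Finset.sum_apply, abs_lt] at hlt
    have e : frobEstimate n (bilinearSketch (Matrix.diagonal a) Y) =
        Real.sqrt ((1 / n : ℝ) * ∑ i, Q i Y ^ 2) := by
      simp only [frobEstimate, bilinearSketch_diagonal_apply, Q]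
    rw [e]
    constructor
    · refine Real.le_sqrt_of_sq_le ?_
      rw [one_div, inv_mul_eq_div, le_div_iff₀ hn0]
      nlinarith [hlt.1]
    · refine Real.sqrt_le_iff.2 ⟨by positivity, ?_⟩
      rw [one_div, inv_mul_eq_div, div_le_iff₀ hn0]
      have : 0 < (n : ℝ) * frobNorm A ^ 2 := by positivity
      nlinarith [hlt.2]
  · have hn' : (1600 : ℝ) ≤ n := by exact_mod_cast hn
    rw [div_le_iff₀ (by positivity)]
    refine hvar.trans ?_
    have hp : 0 < (frobNorm A ^ 2) ^ 2 * n := by positivity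
    nlinarith [mul_le_mul_of_nonneg_left hn' hp.le]

/-! ### Sub-Gaussian lower tail of a PSD quadratic form. -/

/-- Since `exp u ≥ 1 + u + u²/2`, it is enough that `(1 + u + u²/2)(1 - u + u²/2) = 1 + u⁴/4 ≥ 1`.
-/
theorem exp_neg_le_quadratic {u : ℝ} (hu : 0 ≤ u) : Real.exp (-u) ≤ 1 - u + u ^ 2 / 2 := by
  have h1 := Real.quadratic_le_exp_of_nonneg hu
  have h2 : 0 < 1 + u + u ^ 2 / 2 := by positivity
  rw [Real.exp_neg]
  refine (inv_anti₀ h2 h1).trans ?_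
  rw [inv_le_iff_one_le_mul₀ h2]
  nlinarith [sq_nonneg (u ^ 2)]

section LowerTail

variable {κ : Type} [Fintype κ]

theorem integrable_exp_neg_mul_dotProduct_sq (y : κ → ℝ) {b : ℝ} (hb : 0 ≤ b) :
    Integrable (fun g => Real.exp (-(b * (g ⬝ᵥ y) ^ 2))) (stdPi κ) := by
  have hm := measurable_dotProduct_right y
  refine Integrable.of_bound (C := 1) (by fun_prop) (Filter.Eventually.of_forall fun g => ?_)
  rw [Real.norm_eq_abs, Real.abs_exp, Real.exp_le_one_iff]
  have : 0 ≤ b * (g ⬝ᵥ y) ^ 2 := by positivity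
  linarith

theorem integral_exp_neg_mul_dotProduct_sq_le (y : κ → ℝ) {b : ℝ} (hb : 0 ≤ b) :
    ∫ g, Real.exp (-(b * (g ⬝ᵥ y) ^ 2)) ∂(stdPi κ) ≤
      Real.exp (-(b * (y ⬝ᵥ y)) + 3 / 2 * b ^ 2 * (y ⬝ᵥ y) ^ 2) := by
  have hs : ∑ j, y j ^ 2 = y ⬝ᵥ y := by simp only [dotProduct, sq]
  have i2 : Integrable (fun g => (g ⬝ᵥ y) ^ 2) (stdPi κ) :=
    MemLp.integrable_pow_of_le (p := 2) (memLp_dotProduct_stdPi y 2) le_rfl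
  have i4 : Integrable (fun g => (g ⬝ᵥ y) ^ 4) (stdPi κ) :=
    MemLp.integrable_pow_of_le (p := 4) (memLp_dotProduct_stdPi y 4) le_rfl
  have i1 : Integrable (fun g => 1 - b * (g ⬝ᵥ y) ^ 2) (stdPi κ) :=
    (integrable_const (1 : ℝ)).sub (i2.const_mul b)
  calc ∫ g, Real.exp (-(b * (g ⬝ᵥ y) ^ 2)) ∂(stdPi κ)
      ≤ ∫ g, (1 - b * (g ⬝ᵥ y) ^ 2 + b ^ 2 / 2 * (g ⬝ᵥ y) ^ 4) ∂(stdPi κ) := by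
        refine integral_mono (integrable_exp_neg_mul_dotProduct_sq y hb)
          (i1.fun_add (i4.const_mul _)) fun g => ?_
        refine (exp_neg_le_quadratic (by positivity : 0 ≤ b * (g ⬝ᵥ y) ^ 2)).trans (le_of_eq ?_)
        ring
    _ = 1 + (-(b * (y ⬝ᵥ y)) + 3 / 2 * b ^ 2 * (y ⬝ᵥ y) ^ 2) := by
        rw [integral_add i1 (i4.const_mul _),
          integral_sub (integrable_const 1) (i2.const_mul b), integral_const_mul,
          integral_const_mul, integral_dotProduct_sq_stdPi, integral_dotProduct_pow_four_stdPi, hs]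
        simp
        ring
    _ ≤ _ := by
        rw [add_comm]
        exact Real.add_one_le_exp _

theorem exp_deviation_eq {d : ℕ} (a : Fin d → ℝ) (y : κ → ℝ) (θ s : ℝ) (Y : Fin d → κ → ℝ) :
    Real.exp (θ * ((∑ r, a r) * s - ∑ r, a r * (Y r ⬝ᵥ y) ^ 2)) =
      Real.exp (θ * (∑ r, a r) * s) * ∏ r, Real.exp (-(θ * a r * (Y r ⬝ᵥ y) ^ 2)) := by
  rw [← Real.exp_sum, ← Real.exp_add, Finset.sum_neg_distrib, mul_sub,
    Finset.mul_sum (f := fun r => a r * (Y r ⬝ᵥ y) ^ 2)]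
  simp only [mul_assoc, sub_eq_add_neg]

theorem integrable_prod_exp_neg {d : ℕ} {b : Fin d → ℝ} (hb : ∀ r, 0 ≤ b r) (y : κ → ℝ) :
    Integrable (fun Y : Fin d → κ → ℝ => ∏ r, Real.exp (-(b r * (Y r ⬝ᵥ y) ^ 2)))
      (Measure.pi fun _ : Fin d => stdPi κ) :=
  Integrable.fintype_prod (f := fun r (g : κ → ℝ) => Real.exp (-(b r * (g ⬝ᵥ y) ^ 2)))
    fun r => integrable_exp_neg_mul_dotProduct_sq y (hb r)

theorem integral_prod_exp_neg_le {d : ℕ} {b : Fin d → ℝ} (hb : ∀ r, 0 ≤ b r) (y : κ → ℝ) :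
    ∫ Y : Fin d → κ → ℝ, ∏ r, Real.exp (-(b r * (Y r ⬝ᵥ y) ^ 2))
        ∂(Measure.pi fun _ : Fin d => stdPi κ) ≤
      Real.exp (-((∑ r, b r) * (y ⬝ᵥ y)) + 3 / 2 * (∑ r, b r ^ 2) * (y ⬝ᵥ y) ^ 2) := by
  rw [integral_fintype_prod_eq_prod (μ := fun _ : Fin d => stdPi κ)
    (f := fun r (g : κ → ℝ) => Real.exp (-(b r * (g ⬝ᵥ y) ^ 2)))]
  refine (Finset.prod_le_prod (fun r _ => integral_nonneg fun g => (Real.exp_pos _).le)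
    fun r _ => integral_exp_neg_mul_dotProduct_sq_le y (hb r)).trans (le_of_eq ?_)
  rw [← Real.exp_sum, Finset.sum_add_distrib, Finset.sum_neg_distrib, Finset.sum_mul,
    Finset.mul_sum, Finset.sum_mul]

/-- The linear terms of the row-wise bounds cancel against the mean. The factor 3/2 is half of the 3
in `E (g·y)⁴ = 3‖y‖⁴`. -/
theorem mgf_deviation_le {d : ℕ} {a : Fin d → ℝ} (ha : ∀ r, 0 ≤ a r) (y : κ → ℝ) {θ : ℝ}
    (hθ : 0 ≤ θ) :
    mgf (fun Y : Fin d → κ → ℝ => (∑ r, a r) * (y ⬝ᵥ y) - ∑ r, a r * (Y r ⬝ᵥ y) ^ 2)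
      (Measure.pi fun _ : Fin d => stdPi κ) θ ≤
      Real.exp (3 / 2 * θ ^ 2 * (∑ r, a r ^ 2) * (y ⬝ᵥ y) ^ 2) := by
  unfold mgf
  simp_rw [exp_deviation_eq]
  rw [integral_const_mul]
  refine (mul_le_mul_of_nonneg_left (integral_prod_exp_neg_le
    (fun r => mul_nonneg hθ (ha r)) y) (Real.exp_pos _).le).trans (le_of_eq ?_)
  rw [← Real.exp_add, ← Finset.mul_sum]
  simp_rw [mul_pow]
  rw [← Finset.mul_sum]
  congr 1
  ring

/-- The lower tail of a quadratic form of a PSD sketch is sub-Gaussian. -/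
theorem real_quadraticForm_lower_tail_le {d : ℕ} {a : Fin d → ℝ} (ha : ∀ r, 0 ≤ a r) {F : ℝ}
    (hF : 0 < F) (hF2 : F ^ 2 = ∑ r, a r ^ 2) (y : κ → ℝ) (hy : y ⬝ᵥ y ≤ 4) {t : ℝ}
    (ht : 0 ≤ t) :
    (Measure.pi fun _ : Fin d => stdPi κ).real
      {Y : Fin d → κ → ℝ | t ≤ (∑ r, a r) * (y ⬝ᵥ y) - ∑ r, a r * (Y r ⬝ᵥ y) ^ 2} ≤
      Real.exp (-(t ^ 2 / (96 * F ^ 2))) := by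
  -- With `‖y‖⁴ ≤ 16` the exponent is at most `-θt + 24θ²F²`, which is minimal at this `θ`.
  obtain ⟨θ, hθ⟩ : ∃ θ, θ = t / (48 * F ^ 2) := ⟨_, rfl⟩
  have hθ0 : 0 ≤ θ := by rw [hθ]; positivity
  have hs0 : 0 ≤ y ⬝ᵥ y := Finset.sum_nonneg fun j _ => mul_self_nonneg _
  have hint : Integrable (fun Y : Fin d → κ → ℝ =>
      Real.exp (θ * ((∑ r, a r) * (y ⬝ᵥ y) - ∑ r, a r * (Y r ⬝ᵥ y) ^ 2)))
      (Measure.pi fun _ : Fin d => stdPi κ) := by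
    simp_rw [exp_deviation_eq]
    exact (integrable_prod_exp_neg (fun r => mul_nonneg hθ0 (ha r)) y).const_mul _
  refine (measure_ge_le_exp_mul_mgf t hθ0 hint).trans ?_
  refine (mul_le_mul_of_nonneg_left (mgf_deviation_le ha y hθ0) (Real.exp_pos _).le).trans ?_
  rw [← hF2, ← Real.exp_add, Real.exp_le_exp]
  have h16 : (y ⬝ᵥ y) ^ 2 ≤ 4 ^ 2 := by gcongr
  have h1 : 3 / 2 * θ ^ 2 * F ^ 2 * (y ⬝ᵥ y) ^ 2 ≤ 3 / 2 * θ ^ 2 * F ^ 2 * 4 ^ 2 :=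
    mul_le_mul_of_nonneg_left h16 (by positivity)
  have h2 : -θ * t + 3 / 2 * θ ^ 2 * F ^ 2 * 4 ^ 2 = -(t ^ 2 / (96 * F ^ 2)) := by
    rw [hθ]
    field_simp
    ring
  linarith

end LowerTail

/-! ### Discretization of the sphere, and the sketch of a PSD matrix. -/

section Grid

/-- The points of the cube `[-1,1]^k` with coordinates in `(1/N)ℤ`. -/
noncomputable def gridPoint {k : ℕ} (N : ℕ) (c : Fin k → Fin (2 * N + 1)) : Fin k → ℝ :=
  fun i => ((c i : ℕ) : ℝ) / N - 1

theorem exists_gridPoint_near {k N : ℕ} (hN : 0 < N) (x : Fin k → ℝ) (hx : x ⬝ᵥ x = 1) :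
    ∃ c : Fin k → Fin (2 * N + 1),
      (x - gridPoint N c) ⬝ᵥ (x - gridPoint N c) ≤ k / (N : ℝ) ^ 2 := by
  have hN0 : (0 : ℝ) < N := by exact_mod_cast hN
  have hxi : ∀ i, |x i| ≤ 1 := by
    intro i
    rw [← sq_le_one_iff_abs_le_one, ← hx, sq]
    exact Finset.single_le_sum (f := fun i => x i * x i) (fun j _ => mul_self_nonneg _)
      (Finset.mem_univ i)
  have hle : ∀ i, ⌊N * (x i + 1)⌋₊ < 2 * N + 1 := by
    intro i
    rw [Nat.lt_succ_iff]
    refine Nat.floor_le_of_le ?_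
    push_cast
    nlinarith [(abs_le.1 (hxi i)).2]
  refine ⟨fun i => ⟨⌊N * (x i + 1)⌋₊, hle i⟩, ?_⟩
  have h : ∀ i, (x i - ((⌊N * (x i + 1)⌋₊ : ℝ) / N - 1)) ^ 2 ≤ 1 / (N : ℝ) ^ 2 := by
    intro i
    have h1 : (0 : ℝ) ≤ N * (x i + 1) := mul_nonneg hN0.le (by linarith [(abs_le.1 (hxi i)).1])
    have h2 := Nat.floor_le h1
    have h3 := Nat.lt_floor_add_one ((N : ℝ) * (x i + 1))
    have e : x i - ((⌊N * (x i + 1)⌋₊ : ℝ) / N - 1) =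
        (N * (x i + 1) - ⌊N * (x i + 1)⌋₊) / N := by
      field_simp
      ring
    rw [e, div_pow]
    gcongr
    rw [sq_le_one_iff_abs_le_one, abs_le]
    constructor <;> linarith
  calc _ = ∑ i, (x i - ((⌊N * (x i + 1)⌋₊ : ℝ) / N - 1)) ^ 2 := by
        simp only [dotProduct, gridPoint, Pi.sub_apply, sq]
    _ ≤ ∑ _i : Fin k, 1 / (N : ℝ) ^ 2 := Finset.sum_le_sum fun i _ => h i
    _ = _ := by simp [div_eq_mul_inv]

theorem sq_dotProduct_mulVec_le {κ : Type} [Fintype κ] (M : Matrix κ κ ℝ) (u v : κ → ℝ) :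
    (u ⬝ᵥ M.mulVec v) ^ 2 ≤ frobNorm M ^ 2 * ((u ⬝ᵥ u) * (v ⬝ᵥ v)) := by
  have h := Finset.sum_mul_sq_le_sq_mul_sq (Finset.univ : Finset (κ × κ)) (fun p => M p.1 p.2)
    (fun p => u p.1 * v p.2)
  rw [frobNorm_sq]
  simp only [Fintype.sum_prod_type] at h
  refine (le_of_eq ?_).trans (h.trans (le_of_eq ?_))
  · congr 1
    simp only [dotProduct, Matrix.mulVec, Finset.mul_sum]
    exact Finset.sum_congr rfl fun i _ => Finset.sum_congr rfl fun j _ => by ring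
  · congr 1
    simp only [dotProduct, Finset.sum_mul_sum]
    exact Finset.sum_congr rfl fun i _ => Finset.sum_congr rfl fun j _ => by ring

/-- For symmetric `M` the difference of the two forms is `(x - y)ᵀ M (x + y)`. -/
theorem sq_quadraticForm_sub_le {κ : Type} [Fintype κ] {M : Matrix κ κ ℝ} (hM : M.IsSymm)
    (x y : κ → ℝ) :
    (x ⬝ᵥ M.mulVec x - y ⬝ᵥ M.mulVec y) ^ 2 ≤
      frobNorm M ^ 2 * (((x - y) ⬝ᵥ (x - y)) * ((x + y) ⬝ᵥ (x + y))) := by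
  refine le_of_eq_of_le ?_ (sq_dotProduct_mulVec_le M (x - y) (x + y))
  congr 1
  have : y ⬝ᵥ M.mulVec x = x ⬝ᵥ M.mulVec y := by
    rw [Matrix.dotProduct_mulVec, ← Matrix.mulVec_transpose, hM.eq, dotProduct_comm]
  rw [Matrix.mulVec_add, sub_dotProduct, dotProduct_add, dotProduct_add, this]
  ring

end Grid

/-- The deviation of the sketch of a diagonal matrix from its mean. -/
noncomputable def sketchDeviation {d : ℕ} {κ : Type} [DecidableEq κ] (a : Fin d → ℝ)
    (Y : Matrix (Fin d) κ ℝ) : Matrix κ κ ℝ :=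
  (∑ r, a r) • (1 : Matrix κ κ ℝ) - bilinearSketch (Matrix.diagonal a) Y

theorem sketchDeviation_isSymm {d : ℕ} {κ : Type} [DecidableEq κ] (a : Fin d → ℝ)
    (Y : Matrix (Fin d) κ ℝ) : (sketchDeviation a Y).IsSymm :=
  (Matrix.isSymm_one.smul _).sub (bilinearSketch_isSymm (Matrix.isSymm_diagonal a) Y)

section Deviation

variable {d : ℕ} {κ : Type} [Fintype κ] [DecidableEq κ]

theorem dotProduct_sketchDeviation (a : Fin d → ℝ) (Y : Matrix (Fin d) κ ℝ) (x : κ → ℝ) :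
    x ⬝ᵥ (sketchDeviation a Y).mulVec x =
      (∑ r, a r) * (x ⬝ᵥ x) - ∑ r, a r * (Y r ⬝ᵥ x) ^ 2 := by
  rw [sketchDeviation, Matrix.sub_mulVec, dotProduct_sub, dotProduct_bilinearSketch_diagonal,
    Matrix.smul_mulVec, Matrix.one_mulVec, dotProduct_smul, smul_eq_mul]

theorem integral_sketchDeviation_apply_sq_le (a : Fin d → ℝ) (i j : κ) :
    Integrable (fun Y : Matrix (Fin d) κ ℝ => sketchDeviation a Y i j ^ 2) (gaussianMatrix d κ) ∧
    ∫ Y, sketchDeviation a Y i j ^ 2 ∂(gaussianMatrix d κ) ≤ 3 * ∑ r, a r ^ 2 := by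
  have hf : MemLp (fun x : κ → ℝ => x i * x j) 2 (stdPi κ) :=
    (memLp_apply_mul_apply_stdPi i j).mono_exponent (by norm_num)
  have hS : MemLp (fun Y : Fin d → κ → ℝ => ∑ r, a r * (Y r i * Y r j)) 2
    (Measure.pi fun _ : Fin d => stdPi κ) := memLp_rowSum hf a Finset.univ
  have hmean := integral_rowSum (hf.integrable (by norm_num)) a Finset.univ
  have hvar := variance_rowSum hf a
  have e : ∀ Y : Matrix (Fin d) κ ℝ, sketchDeviation a Y i j ^ 2 =
      (∑ r, a r * (Y r i * Y r j) - (∑ r, a r) * if i = j then 1 else 0) ^ 2 := by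
    intro Y
    rw [sketchDeviation, Matrix.sub_apply, bilinearSketch_diagonal_apply, Matrix.smul_apply,
      Matrix.one_apply, smul_eq_mul, ← neg_sq, neg_sub]
  simp_rw [e]
  rw [variance_eq_integral hS.aestronglyMeasurable.aemeasurable, hmean,
    integral_apply_mul_apply_stdPi] at hvar
  constructor
  · exact (hS.sub (memLp_const _)).integrable_sq
  · refine (le_of_eq hvar).trans ?_
    exact mul_le_mul_of_nonneg_right (variance_apply_mul_apply_stdPi_le i j)
      (Finset.sum_nonneg fun _ _ => sq_nonneg _)

/-- Markov's inequality: each of the `k²` entries has mean square at most `3F²`, and `3/225 ≤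
0.014`. The bound is weak, but it only has to control the passage from the grid to the sphere. -/
theorem real_frobNorm_sketchDeviation_le (a : Fin d → ℝ) {F : ℝ} (hF : 0 < F)
    (hF2 : F ^ 2 = ∑ r, a r ^ 2) (hκ : 0 < Fintype.card κ) :
    (gaussianMatrix d κ).real
      {Y | (15 * Fintype.card κ * F) ^ 2 ≤ frobNorm (sketchDeviation a Y) ^ 2} ≤ 0.014 := by
  have hk : (0 : ℝ) < Fintype.card κ := by exact_mod_cast hκ
  have hint : Integrable (fun Y : Matrix (Fin d) κ ℝ => frobNorm (sketchDeviation a Y) ^ 2)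
      (gaussianMatrix d κ) := by
    simp_rw [frobNorm_sq]
    exact integrable_finsetSum _ fun i _ => integrable_finsetSum _ fun j _ =>
      (integral_sketchDeviation_apply_sq_le a i j).1
  have hle : ∫ Y, frobNorm (sketchDeviation a Y) ^ 2 ∂(gaussianMatrix d κ) ≤
      3 * (Fintype.card κ * F) ^ 2 := by
    simp_rw [frobNorm_sq]
    rw [integral_finsetSum _ fun i _ => integrable_finsetSum _ fun j _ =>
      (integral_sketchDeviation_apply_sq_le a i j).1]
    simp_rw [fun i => integral_finsetSum (μ := gaussianMatrix d κ) Finset.univ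
      fun j _ => (integral_sketchDeviation_apply_sq_le a i j).1]
    refine (Finset.sum_le_sum fun i _ => Finset.sum_le_sum fun j _ =>
      (integral_sketchDeviation_apply_sq_le a i j).2).trans (le_of_eq ?_)
    rw [← hF2]
    simp only [Finset.sum_const, Finset.card_univ, nsmul_eq_mul]
    ring
  have h := mul_meas_ge_le_integral_of_nonneg (μ := gaussianMatrix d κ)
    (Filter.Eventually.of_forall fun Y => sq_nonneg (frobNorm (sketchDeviation a Y))) hint
    ((15 * Fintype.card κ * F) ^ 2)
  have hp : 0 < (Fintype.card κ * F) ^ 2 := by positivity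
  set p := (gaussianMatrix d κ).real
    {Y | (15 * Fintype.card κ * F) ^ 2 ≤ frobNorm (sketchDeviation a Y) ^ 2}
  have : 225 * p * (Fintype.card κ * F) ^ 2 ≤ 3 * (Fintype.card κ * F) ^ 2 := by
    refine le_trans (le_of_eq ?_) (h.trans hle)
    ring
  have := le_of_mul_le_mul_right this hp
  linarith

end Deviation

theorem one_le_log_of_three_le {k : ℕ} (hk : 3 ≤ k) : 1 ≤ Real.log k := by
  rw [Real.le_log_iff_exp_le (by positivity)]
  have h3 : (3 : ℝ) ≤ k := by exact_mod_cast hk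
  linarith [Real.exp_one_lt_d9]

/-- The grid has at most `exp(3k log k)` points, while the tail exponent is `(28²/96) k log² k`,
more than `8 k log² k`. -/
theorem card_grid_mul_exp_le {k : ℕ} (hk : 3 ≤ k) {F : ℝ} (hF : 0 < F) :
    ((2 * k ^ 2 + 1 : ℕ) : ℝ) ^ k *
      Real.exp (-((28 * Real.sqrt k * Real.log k * F) ^ 2 / (96 * F ^ 2))) ≤ 0.01 := by
  have h3 : (3 : ℝ) ≤ k := by exact_mod_cast hk
  have hl := one_le_log_of_three_le hk
  have hk0 : (0 : ℝ) < k := by linarith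
  have h1 : ((2 * k ^ 2 + 1 : ℕ) : ℝ) ≤ Real.exp (3 * Real.log k) := by
    rw [show (3 : ℝ) * Real.log k = (3 : ℕ) * Real.log k by norm_num, Real.exp_nat_mul,
      Real.exp_log hk0]
    push_cast
    nlinarith [sq_nonneg (k : ℝ), mul_le_mul_of_nonneg_right h3 (sq_nonneg (k : ℝ))]
  have h2 : (28 * Real.sqrt k * Real.log k * F) ^ 2 / (96 * F ^ 2) =
      784 / 96 * (k * Real.log k ^ 2) := by
    rw [mul_pow, mul_pow, mul_pow, Real.sq_sqrt hk0.le]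
    field_simp
    norm_num
  calc _ ≤ Real.exp (3 * Real.log k) ^ k * Real.exp (-(784 / 96 * (k * Real.log k ^ 2))) := by
        rw [h2]; gcongr
    _ = Real.exp (k * (3 * Real.log k) - 784 / 96 * (k * Real.log k ^ 2)) := by
        rw [← Real.exp_nat_mul, ← Real.exp_add, sub_eq_add_neg]
    _ ≤ Real.exp (-5) := by
        rw [Real.exp_le_exp]
        have h5 : Real.log k ≤ Real.log k ^ 2 := by nlinarith
        have h6 : (3 : ℝ) ≤ k * Real.log k ^ 2 := by nlinarith
        nlinarith [mul_le_mul_of_nonneg_left h5 hk0.le]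
    _ ≤ 0.01 := by
        rw [Real.exp_neg, inv_le_comm₀ (Real.exp_pos _) (by norm_num)]
        have h7 : Real.exp 5 = Real.exp 1 ^ 5 := by rw [← Real.exp_nat_mul]; norm_num
        rw [h7]
        calc ((0.01 : ℝ)⁻¹) ≤ 2.7 ^ 5 := by norm_num
          _ ≤ _ := by gcongr; linarith [Real.exp_one_gt_d9]

/-- The smallest eigenvalue of the sketch of a PSD diagonal matrix is not much smaller than
the trace. -/
theorem real_lambdaMin_sketch_lt_le {d k : ℕ} (hk : 3 ≤ k) {a : Fin d → ℝ} (ha : ∀ r, 0 ≤ a r)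
    {F : ℝ} (hF : 0 < F) (hF2 : F ^ 2 = ∑ r, a r ^ 2) :
    (gaussianMatrix d (Fin k)).real
      {Y | lambdaMin (bilinearSketch (Matrix.diagonal a) Y) <
        ∑ r, a r - (28 * Real.sqrt k * Real.log k + 45) * F} ≤ 0.03 := by
  have h3 : (3 : ℝ) ≤ k := by exact_mod_cast hk
  have hk0 : (0 : ℝ) < k := by linarith
  have hl := one_le_log_of_three_le hk
  have : Nonempty (Fin k) := ⟨⟨0, by omega⟩⟩
  set t := 28 * Real.sqrt k * Real.log k * F with ht
  have ht0 : 0 ≤ t := by positivity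
  -- Spacing `1/k²` gives `‖x - y‖² ≤ 1/k³`, which offsets the `k²` in the squared Frobenius bound.
  let N := k ^ 2
  have hN : 0 < N := by positivity
  let T : Finset (Fin k → Fin (2 * N + 1)) :=
    Finset.univ.filter fun c => gridPoint N c ⬝ᵥ gridPoint N c ≤ 4
  let B0 : Set (Matrix (Fin d) (Fin k) ℝ) :=
    {Y | (15 * Fintype.card (Fin k) * F) ^ 2 ≤ frobNorm (sketchDeviation a Y) ^ 2}
  let B : (Fin k → Fin (2 * N + 1)) → Set (Matrix (Fin d) (Fin k) ℝ) := fun c =>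
    {Y | t ≤ (∑ r, a r) * (gridPoint N c ⬝ᵥ gridPoint N c) -
      ∑ r, a r * (Y r ⬝ᵥ gridPoint N c) ^ 2}
  have hsub : {Y | lambdaMin (bilinearSketch (Matrix.diagonal a) Y) <
      ∑ r, a r - (28 * Real.sqrt k * Real.log k + 45) * F} ⊆ B0 ∪ ⋃ c ∈ T, B c := by
    intro Y hY
    by_contra hcon
    rw [Set.mem_union, not_or] at hcon
    obtain ⟨h0, h1⟩ := hcon
    refine absurd (le_lambdaMin_of_unit
      (bilinearSketch_isSymm (Matrix.isSymm_diagonal a) Y) fun x hx => ?_) (not_le.2 hY)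
    obtain ⟨c, hc⟩ := exists_gridPoint_near hN x hx
    set y := gridPoint N c with hy
    have hN3 : (k : ℝ) / (N : ℝ) ^ 2 = 1 / (k : ℝ) ^ 3 := by
      simp only [N]; push_cast; field_simp
    rw [hN3] at hc
    have hpar : (x + y) ⬝ᵥ (x + y) + (x - y) ⬝ᵥ (x - y) = 2 * (x ⬝ᵥ x) + 2 * (y ⬝ᵥ y) := by
      simp only [add_dotProduct, dotProduct_add, sub_dotProduct, dotProduct_sub]; ring
    have hk3 : 1 / (k : ℝ) ^ 3 ≤ 1 / 27 := by
      refine one_div_le_one_div_of_le (by norm_num) ?_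
      calc (27 : ℝ) = 3 ^ 3 := by norm_num
        _ ≤ _ := by gcongr
    have hyb : y ⬝ᵥ y ≤ 4 := by
      -- The parallelogram law for `x` and `x - y`.
      have h2 : y ⬝ᵥ y + ((2 : ℝ) • x - y) ⬝ᵥ ((2 : ℝ) • x - y) =
          2 * (x ⬝ᵥ x) + 2 * ((x - y) ⬝ᵥ (x - y)) := by
        simp only [sub_dotProduct, dotProduct_sub, smul_dotProduct, dotProduct_smul, smul_eq_mul]
        rw [dotProduct_comm y x]
        ring
      have h4 : 0 ≤ ((2 : ℝ) • x - y) ⬝ᵥ ((2 : ℝ) • x - y) :=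
        Finset.sum_nonneg fun j _ => mul_self_nonneg _
      rw [hx] at h2
      linarith
    have hsum : (x + y) ⬝ᵥ (x + y) ≤ 10 := by
      have h4 : 0 ≤ (x - y) ⬝ᵥ (x - y) := Finset.sum_nonneg fun j _ => mul_self_nonneg _
      rw [hx] at hpar
      linarith
    have hcT : Y ∉ B c := fun h => h1 (Set.mem_biUnion (by simpa [T] using hyb) h)
    have hqy : y ⬝ᵥ (sketchDeviation a Y).mulVec y < t := by
      rw [dotProduct_sketchDeviation]
      exact not_le.1 hcT
    have hfr : frobNorm (sketchDeviation a Y) ^ 2 ≤ (15 * k * F) ^ 2 := by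
      have : frobNorm (sketchDeviation a Y) ^ 2 < (15 * Fintype.card (Fin k) * F) ^ 2 :=
        not_le.1 h0
      rw [Fintype.card_fin] at this
      exact this.le
    have hdiff := sq_quadraticForm_sub_le (sketchDeviation_isSymm a Y) x y
    have hdiff2 : (x ⬝ᵥ (sketchDeviation a Y).mulVec x - y ⬝ᵥ (sketchDeviation a Y).mulVec y) ^ 2 ≤
        (45 * F) ^ 2 := by
      refine hdiff.trans ?_
      calc _ ≤ (15 * k * F) ^ 2 * (1 / (k : ℝ) ^ 3 * 10) := by
            gcongr
            · exact mul_nonneg (Finset.sum_nonneg fun j _ => mul_self_nonneg _)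
                (Finset.sum_nonneg fun j _ => mul_self_nonneg _)
            · exact Finset.sum_nonneg fun j _ => mul_self_nonneg _
        _ = 2250 * F ^ 2 * (1 / k) := by field_simp; norm_num
        _ ≤ 2250 * F ^ 2 * (1 / 3) := by gcongr
        _ ≤ _ := by nlinarith [sq_nonneg F]
    have hab := abs_le_of_sq_le_sq hdiff2 (by positivity)
    have hqx : x ⬝ᵥ (sketchDeviation a Y).mulVec x ≤ t + 45 * F := by
      linarith [(abs_le.1 hab).2]
    rw [dotProduct_sketchDeviation, hx] at hqx
    rw [dotProduct_bilinearSketch_diagonal]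
    linarith
  have hB0 : (gaussianMatrix d (Fin k)).real B0 ≤ 0.014 :=
    real_frobNorm_sketchDeviation_le a hF hF2 (by simp; omega)
  have hB : (gaussianMatrix d (Fin k)).real (⋃ c ∈ T, B c) ≤ 0.01 := by
    refine (measureReal_biUnion_finset_le _ _).trans ?_
    refine (Finset.sum_le_card_nsmul _ _ (Real.exp (-(t ^ 2 / (96 * F ^ 2)))) fun c hc =>
      real_quadraticForm_lower_tail_le ha hF hF2 (gridPoint N c)
        (Finset.mem_filter.1 hc).2 ht0).trans ?_
    rw [nsmul_eq_mul]
    refine le_trans ?_ (card_grid_mul_exp_le hk hF)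
    refine mul_le_mul_of_nonneg_right ?_ (Real.exp_pos _).le
    have : T.card ≤ (2 * k ^ 2 + 1) ^ k := by
      refine (Finset.card_le_univ T).trans (le_of_eq ?_)
      simp [N]
    exact_mod_cast this
  refine (measureReal_mono hsub (measure_ne_top _ _)).trans ?_
  refine (measureReal_union_le _ _).trans ?_
  linarith

/-! ### The sketch of a matrix with a very negative eigenvalue. -/

theorem real_norm_sq_row_lt_le {d k : ℕ} (hk : 0 < k) (r : Fin d) :
    (gaussianMatrix d (Fin k)).real {Y | Y r ⬝ᵥ Y r < k / 2} ≤ 8 / k := by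
  have hk0 : (0 : ℝ) < k := by exact_mod_cast hk
  have hmp : MeasurePreserving (fun Y : Matrix (Fin d) (Fin k) ℝ => Y r)
      (gaussianMatrix d (Fin k)) (stdPi (Fin k)) :=
    measurePreserving_eval (fun _ : Fin d => stdPi (Fin k)) r
  have h := meas_ge_le_variance_div_sq (memLp_norm_sq_stdPi (κ := Fin k))
    (show (0 : ℝ) < k / 2 by positivity)
  rw [variance_norm_sq_stdPi, integral_norm_sq_stdPi, Fintype.card_fin] at h
  have h' := ENNReal.toReal_le_of_le_ofReal (by positivity) h
  have h1 : (gaussianMatrix d (Fin k)).real {Y | Y r ⬝ᵥ Y r < k / 2} ≤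
      (stdPi (Fin k)).real {x | x ⬝ᵥ x < k / 2} :=
    ENNReal.toReal_mono (measure_ne_top _ _) (hmp.measure_preimage_le {x | x ⬝ᵥ x < k / 2})
  refine h1.trans ((measureReal_mono ?_ (measure_ne_top _ _)).trans (h'.trans (le_of_eq ?_)))
  · intro x hx
    have hx' : x ⬝ᵥ x < k / 2 := hx
    simp only [dotProduct, ← sq] at hx'
    change (k : ℝ) / 2 ≤ |∑ j, x j ^ 2 - k|
    rw [abs_sub_comm]
    refine le_trans ?_ (le_abs_self _)
    linarith
  · field_simp
    norm_num

/-- The rows other than `i₀` behave like independent rows with respect to the direction of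
row `i₀`. -/
theorem real_offRow_deviation_le {n k : ℕ} (i₀ : Fin (n + 1)) (a : Fin (n + 1) → ℝ) {F : ℝ}
    (hF : 0 < F) (hF2 : F ^ 2 = ∑ r, a r ^ 2) :
    (gaussianMatrix (n + 1) (Fin k)).real
      {Y | 15 * F * (Y i₀ ⬝ᵥ Y i₀) < ∑ j : Fin n, a (i₀.succAbove j) *
        ((Y (i₀.succAbove j) ⬝ᵥ Y i₀) ^ 2 - Y i₀ ⬝ᵥ Y i₀)} ≤ 0.01 := by
  have hmp := measurePreserving_piFinSuccAbove (fun _ : Fin (n + 1) => stdPi (Fin k)) i₀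
  let B : Set ((Fin k → ℝ) × (Fin n → Fin k → ℝ)) :=
    {p | 15 * F * (p.1 ⬝ᵥ p.1) < ∑ j : Fin n, a (i₀.succAbove j) *
        ((p.2 j ⬝ᵥ p.1) ^ 2 - p.1 ⬝ᵥ p.1)}
  have hBm : MeasurableSet B := by
    apply measurableSet_lt
    · unfold dotProduct; fun_prop
    · unfold dotProduct; fun_prop
  -- With row `i₀` frozen at `g`, the variables `(g_j·g)²` are independent with mean `‖g‖²` and
  -- variance `2‖g‖⁴`; Chebyshev gives `2/225`, uniformly in `g`, and Fubini removes the
  -- conditioning.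
  have hsec : ∀ g : Fin k → ℝ,
      (Measure.pi fun _ : Fin n => stdPi (Fin k)) (Prod.mk g ⁻¹' B) ≤ ENNReal.ofReal 0.01 := by
    intro g
    have hg0 : 0 ≤ g ⬝ᵥ g := Finset.sum_nonneg fun j _ => mul_self_nonneg _
    have hsum : ∑ j : Fin n, a (i₀.succAbove j) ^ 2 ≤ F ^ 2 := by
      rw [hF2, Fin.sum_univ_succAbove _ i₀]
      linarith [sq_nonneg (a i₀)]
    rcases hg0.eq_or_lt with h0 | hpos
    · have hg : g = 0 := dotProduct_self_eq_zero.1 h0.symm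
      subst hg
      rw [show Prod.mk (0 : Fin k → ℝ) ⁻¹' B = ∅ by
        ext R; simp [B]]
      simp
    · have ht : 0 < 15 * F * (g ⬝ᵥ g) := by positivity
      have h := real_rowSum_deviation_le (memLp_dotProduct_sq_stdPi g)
        (fun j : Fin n => a (i₀.succAbove j)) ht
      have hs : ∑ j, g j ^ 2 = g ⬝ᵥ g := by simp only [dotProduct, sq]
      rw [variance_dotProduct_sq_stdPi, integral_dotProduct_sq_stdPi, hs] at h
      have hle : 2 * (g ⬝ᵥ g) ^ 2 * (∑ j : Fin n, a (i₀.succAbove j) ^ 2) /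
          (15 * F * (g ⬝ᵥ g)) ^ 2 ≤ 0.01 := by
        rw [div_le_iff₀ (by positivity)]
        have := mul_le_mul_of_nonneg_left hsum (sq_nonneg (g ⬝ᵥ g))
        have h2 : 0 ≤ (g ⬝ᵥ g) ^ 2 * F ^ 2 := by positivity
        nlinarith
      rw [← ofReal_measureReal (measure_ne_top _ _)]
      refine ENNReal.ofReal_le_ofReal ((measureReal_mono ?_ (measure_ne_top _ _)).trans
        (h.trans hle))
      intro R hR
      have hR' : 15 * F * (g ⬝ᵥ g) < ∑ j : Fin n, a (i₀.succAbove j) *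
        ((R j ⬝ᵥ g) ^ 2 - g ⬝ᵥ g) := hR
      change _ ≤ |∑ j : Fin n, a (i₀.succAbove j) * (R j ⬝ᵥ g) ^ 2 -
        (∑ j : Fin n, a (i₀.succAbove j)) * (g ⬝ᵥ g)|
      refine le_trans (le_of_lt hR') (le_trans (le_of_eq ?_) (le_abs_self _))
      rw [Finset.sum_mul, ← Finset.sum_sub_distrib]
      exact Finset.sum_congr rfl fun j _ => by ring
  have hprod : ((stdPi (Fin k)).prod (Measure.pi fun _ : Fin n => stdPi (Fin k))) B ≤
      ENNReal.ofReal 0.01 := by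
    rw [Measure.prod_apply hBm]
    refine (lintegral_mono hsec).trans ?_
    simp
  exact ENNReal.toReal_le_of_le_ofReal (by norm_num) ((hmp.measure_preimage_le B).trans hprod)

/-- A very negative eigenvalue pushes the smallest eigenvalue of the sketch below the trace. -/
theorem real_lt_lambdaMin_sketch_le {d k : ℕ} (hk : 2 ≤ k) (a : Fin d → ℝ) {F ε : ℝ} (hF : 0 < F)
    (hF2 : F ^ 2 = ∑ r, a r ^ 2) (hε : 0 < ε) (hε1 : ε < 1) {i₀ : Fin d} (hi : a i₀ ≤ -(ε * F)) :
    (gaussianMatrix d (Fin k)).real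
      {Y | ∑ r, a r + (16 - ε * k / 2) * F ≤ lambdaMin (bilinearSketch (Matrix.diagonal a) Y)} ≤
      8 / k + 0.01 := by
  obtain ⟨n, rfl⟩ : ∃ n, d = n + 1 := Nat.exists_eq_succ_of_ne_zero (by have := i₀.2; omega)
  have hk2 : (2 : ℝ) ≤ k := by exact_mod_cast hk
  have : Nonempty (Fin k) := ⟨⟨0, by omega⟩⟩
  let B1 : Set (Matrix (Fin (n + 1)) (Fin k) ℝ) := {Y | Y i₀ ⬝ᵥ Y i₀ < k / 2}
  let B2 : Set (Matrix (Fin (n + 1)) (Fin k) ℝ) :=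
    {Y | 15 * F * (Y i₀ ⬝ᵥ Y i₀) < ∑ j : Fin n, a (i₀.succAbove j) *
        ((Y (i₀.succAbove j) ⬝ᵥ Y i₀) ^ 2 - Y i₀ ⬝ᵥ Y i₀)}
  have h1 : (gaussianMatrix (n + 1) (Fin k)).real B1 ≤ 8 / k :=
    real_norm_sq_row_lt_le (by omega) i₀
  have h2 : (gaussianMatrix (n + 1) (Fin k)).real B2 ≤ 0.01 :=
    real_offRow_deviation_le i₀ a hF hF2
  refine (measureReal_mono (s₂ := B1 ∪ B2) ?_ (measure_ne_top _ _)).trans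
    ((measureReal_union_le _ _).trans (add_le_add h1 h2))
  intro Y hY
  by_contra hcon
  rw [Set.mem_union, not_or] at hcon
  have hb1 : (k : ℝ) / 2 ≤ Y i₀ ⬝ᵥ Y i₀ := not_lt.1 hcon.1
  have hb2 : ∑ j : Fin n, a (i₀.succAbove j) * ((Y (i₀.succAbove j) ⬝ᵥ Y i₀) ^ 2 - Y i₀ ⬝ᵥ Y i₀) ≤
    15 * F * (Y i₀ ⬝ᵥ Y i₀) := not_lt.1 hcon.2
  have hY' : ∑ r, a r + (16 - ε * k / 2) * F ≤
    lambdaMin (bilinearSketch (Matrix.diagonal a) Y) := hY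
  -- Row `i₀` is the test vector: its own term in the quadratic form is `a i₀ * s ^ 2`.
  have hlam := lambdaMin_mul_le (bilinearSketch_isSymm (Matrix.isSymm_diagonal a) Y) (Y i₀)
  rw [dotProduct_bilinearSketch_diagonal] at hlam
  rw [Fin.sum_univ_succAbove _ i₀] at hlam hY'
  simp only [mul_sub] at hb2
  rw [Finset.sum_sub_distrib, ← Finset.sum_mul] at hb2
  set s := Y i₀ ⬝ᵥ Y i₀
  set L := lambdaMin (bilinearSketch (Matrix.diagonal a) Y)
  set τ := ∑ j : Fin n, a (i₀.succAbove j)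
  have hs : 0 < s := by linarith
  have hL : L ≤ a i₀ * s + τ + 15 * F := by
    refine le_of_mul_le_mul_right ?_ hs
    nlinarith
  -- The trace contains `a i₀`, which leaves `a i₀ * (s - 1)`. The surplus `εF` is below `F` and
  -- raises 15 to 16.
  have hεF : 0 < ε * F := by positivity
  have h3 : a i₀ * (s - 1) ≤ -(ε * F) * (s - 1) := by
    refine mul_le_mul_of_nonneg_right hi ?_
    linarith
  have h4 : ε * F * (k / 2) ≤ ε * F * s := mul_le_mul_of_nonneg_left hb1 hεF.le
  nlinarith

/-! ### Measurability, and the marginal laws of the two column blocks. -/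

theorem posSemidef_iff_lambdaMin_nonneg {ι : Type} [Fintype ι] [DecidableEq ι] [Nonempty ι]
    {M : Matrix ι ι ℝ} (hM : M.IsSymm) : M.PosSemidef ↔ 0 ≤ lambdaMin M := by
  rw [le_lambdaMin_iff hM, Matrix.posSemidef_iff_dotProduct_mulVec, Matrix.isHermitian_iff_isSymm]
  simp [hM]

/-- Superlevel sets are intersections of closed conditions, one for each test vector, hence closed.
-/
theorem measurable_lambdaMin_bilinearSketch {d : ℕ} {κ : Type} [Fintype κ] [DecidableEq κ]
    [Nonempty κ] {A : Matrix (Fin d) (Fin d) ℝ} (hA : A.IsSymm) :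
    Measurable fun G : Matrix (Fin d) κ ℝ => lambdaMin (bilinearSketch A G) := by
  refine measurable_of_Ici fun c => ?_
  have hset : (fun G : Matrix (Fin d) κ ℝ => lambdaMin (bilinearSketch A G)) ⁻¹' Set.Ici c =
      {G : Matrix (Fin d) κ ℝ | ∀ x : κ → ℝ, c * (x ⬝ᵥ x) ≤
        x ⬝ᵥ (bilinearSketch A G).mulVec x} := by
    ext G
    exact le_lambdaMin_iff (bilinearSketch_isSymm hA G) c
  rw [hset]
  have hcl : IsClosed {G : Fin d → κ → ℝ | ∀ x : κ → ℝ, c * (x ⬝ᵥ x) ≤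
      x ⬝ᵥ (bilinearSketch A (G : Matrix (Fin d) κ ℝ)).mulVec x} := by
    rw [Set.ofPred_forall]
    refine isClosed_iInter fun x => isClosed_le continuous_const ?_
    simp only [bilinearSketch, dotProduct, Matrix.mulVec]
    fun_prop
  exact hcl.measurableSet

theorem measurable_bilinearSketch {d : ℕ} {κ : Type} (A : Matrix (Fin d) (Fin d) ℝ) :
    Measurable fun G : Matrix (Fin d) κ ℝ => bilinearSketch A G := by
  refine measurable_pi_lambda _ fun i => measurable_pi_lambda _ fun j => ?_
  simp only [bilinearSketch, Matrix.mul_apply, Matrix.transpose_apply]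
  exact Finset.measurable_sum _ fun r _ => (Finset.measurable_sum _ fun s _ =>
    (measurable_entry s i).mul_const _).mul (measurable_entry r j)

section Columns

variable {d : ℕ} {κ κ' : Type}

/-- The columns of a matrix indexed by the left summand. -/
def colsLeft (X : Matrix (Fin d) (κ ⊕ κ') ℝ) : Matrix (Fin d) κ ℝ := fun r j => X r (Sum.inl j)

/-- The columns of a matrix indexed by the right summand. -/
def colsRight (X : Matrix (Fin d) (κ ⊕ κ') ℝ) : Matrix (Fin d) κ' ℝ := fun r j => X r (Sum.inr j)

theorem bilinearSketch_toBlocks₁₁ (A : Matrix (Fin d) (Fin d) ℝ)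
    (X : Matrix (Fin d) (κ ⊕ κ') ℝ) :
    (bilinearSketch A X).toBlocks₁₁ = bilinearSketch A (colsLeft X) := rfl

theorem bilinearSketch_toBlocks₂₂ (A : Matrix (Fin d) (Fin d) ℝ)
    (X : Matrix (Fin d) (κ ⊕ κ') ℝ) :
    (bilinearSketch A X).toBlocks₂₂ = bilinearSketch A (colsRight X) := rfl

variable [Fintype κ] [Fintype κ']

theorem measurePreserving_colsLeft :
    MeasurePreserving (colsLeft : Matrix (Fin d) (κ ⊕ κ') ℝ → Matrix (Fin d) κ ℝ)
      (gaussianMatrix d (κ ⊕ κ')) (gaussianMatrix d κ) :=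
  measurePreserving_pi (fun _ : Fin d => stdPi (κ ⊕ κ')) (fun _ => stdPi κ) fun _ =>
    measurePreserving_fst.comp
      (measurePreserving_sumPiEquivProdPi fun _ : κ ⊕ κ' => gaussianReal 0 1)

theorem measurePreserving_colsRight :
    MeasurePreserving (colsRight : Matrix (Fin d) (κ ⊕ κ') ℝ → Matrix (Fin d) κ' ℝ)
      (gaussianMatrix d (κ ⊕ κ')) (gaussianMatrix d κ') :=
  measurePreserving_pi (fun _ : Fin d => stdPi (κ ⊕ κ')) (fun _ => stdPi κ') fun _ =>
    measurePreserving_snd.comp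
      (measurePreserving_sumPiEquivProdPi fun _ : κ ⊕ κ' => gaussianReal 0 1)

theorem real_preimage_colsLeft_le (B : Set (Matrix (Fin d) κ ℝ)) :
    (gaussianMatrix d (κ ⊕ κ')).real (colsLeft ⁻¹' B) ≤ (gaussianMatrix d κ).real B :=
  ENNReal.toReal_mono (measure_ne_top _ _) (measurePreserving_colsLeft.measure_preimage_le B)

theorem real_preimage_colsRight_le (B : Set (Matrix (Fin d) κ' ℝ)) :
    (gaussianMatrix d (κ ⊕ κ')).real (colsRight ⁻¹' B) ≤ (gaussianMatrix d κ').real B :=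
  ENNReal.toReal_mono (measure_ne_top _ _) (measurePreserving_colsRight.measure_preimage_le B)

end Columns

/-! ### Correctness of the tester. -/

section Tester

variable {d k : ℕ} {A : Matrix (Fin d) (Fin d) ℝ}

theorem real_lambdaMin_sketch_lt_le_of_posSemidef (hk : 3 ≤ k) (hA : A.PosSemidef) (h0 : A ≠ 0) :
    (gaussianMatrix d (Fin k)).real {G | lambdaMin (bilinearSketch A G) <
      A.trace - (28 * Real.sqrt k * Real.log k + 45) * frobNorm A} ≤ 0.03 := by
  obtain ⟨a, htr, hfr, hpsd, -, hB⟩ :=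
    exists_diagonal_sketch (Matrix.isHermitian_iff_isSymm.1 hA.isHermitian)
  refine (hB (Fin k) {S | lambdaMin S <
    A.trace - (28 * Real.sqrt k * Real.log k + 45) * frobNorm A}).trans ?_
  rw [htr]
  exact real_lambdaMin_sketch_lt_le hk (hpsd hA) (frobNorm_pos h0) hfr

theorem real_le_lambdaMin_sketch_le_of_far (hk : 2 ≤ k) (hA : A.IsSymm) {ε : ℝ} (hε : 0 < ε)
    (hε1 : ε < 1) (hfar : IsFarFromPSD ε A) :
    (gaussianMatrix d (Fin k)).real
      {G | A.trace + (16 - ε * k / 2) * frobNorm A ≤ lambdaMin (bilinearSketch A G)} ≤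
      8 / k + 0.01 := by
  obtain ⟨a, htr, hfr, -, hmin, hB⟩ := exists_diagonal_sketch hA
  have hd : 0 < d := by
    rcases Nat.eq_zero_or_pos d with rfl | h
    · exact absurd (Subsingleton.elim A 0) hfar.1
    · exact h
  obtain ⟨i₀, hi⟩ := hmin hd
  refine (hB (Fin k) {S | A.trace + (16 - ε * k / 2) * frobNorm A ≤ lambdaMin S}).trans ?_
  rw [htr]
  exact real_lt_lambdaMin_sketch_le hk a (frobNorm_pos hfar.1) hfr hε hε1
    (i₀ := i₀) (hi.trans_le hfar.2)

theorem measurableSet_sketchAccepts {m : ℕ} (hk : 0 < k)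
    {trEst frEst : Matrix (Fin m) (Fin m) ℝ → ℝ} (ht : Measurable trEst) (hf : Measurable frEst)
    (c : ℝ) (hA : A.IsSymm) :
    MeasurableSet {X : Matrix (Fin d) (Fin k ⊕ Fin m) ℝ |
      sketchAccepts trEst frEst c (bilinearSketch A X)} := by
  have : Nonempty (Fin k) := ⟨⟨0, hk⟩⟩
  have hl : Measurable fun X : Matrix (Fin d) (Fin k ⊕ Fin m) ℝ =>
      lambdaMin (bilinearSketch A (colsLeft X)) :=
    (measurable_lambdaMin_bilinearSketch hA).comp measurePreserving_colsLeft.measurable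
  have hS : Measurable fun X : Matrix (Fin d) (Fin k ⊕ Fin m) ℝ =>
      bilinearSketch A (colsRight X) :=
    (measurable_bilinearSketch A).comp measurePreserving_colsRight.measurable
  have hset : {X : Matrix (Fin d) (Fin k ⊕ Fin m) ℝ |
      sketchAccepts trEst frEst c (bilinearSketch A X)} =
      {X | 0 ≤ lambdaMin (bilinearSketch A (colsLeft X))} ∩
      {X | (trEst (bilinearSketch A (colsRight X)) - lambdaMin (bilinearSketch A (colsLeft X))) /
        (frEst (bilinearSketch A (colsRight X)) * Real.sqrt k * Real.log k) ≤ c} := by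
    ext X
    exact and_congr_left' (posSemidef_iff_lambdaMin_nonneg (bilinearSketch_isSymm hA (colsLeft X)))
  rw [hset]
  exact (measurableSet_le measurable_const hl).inter (measurableSet_le
    (((ht.comp hS).sub hl).div (((hf.comp hS).mul_const _).mul_const _)) measurable_const)

theorem one_le_sqrt_mul_log (hk : 3 ≤ k) : 1 ≤ Real.sqrt k * Real.log k := by
  have h1 := one_le_log_of_three_le hk
  have h2 : 1 ≤ Real.sqrt k := by
    rw [Real.one_le_sqrt]
    exact_mod_cast (by omega : 1 ≤ k)
  nlinarith

/-- Put `u = √k log k ≥ 1`. Outside the bad events, a nonzero PSD input has `γ ≤ 2(28u + 46)/u ≤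
148`, and a far input has `γ > (εk/2 - 17)/(2u) > 150` by `hkε`. The bad events add up to at most
0.05, by a union bound that uses only the marginal laws of `G` and `H`. -/
theorem sketchTester_isL2Tester (hk : 1000 ≤ k) {m : ℕ}
    {trEst frEst : Matrix (Fin m) (Fin m) ℝ → ℝ} (ht : Measurable trEst) (hf : Measurable frEst)
    (htr : ∀ A : Matrix (Fin d) (Fin d) ℝ, A.IsSymm → (gaussianMatrix d (Fin m)).real
      {H | frobNorm A < |trEst (bilinearSketch A H) - A.trace|} ≤ 0.01)
    (hfr : ∀ A : Matrix (Fin d) (Fin d) ℝ, A.IsSymm → (gaussianMatrix d (Fin m)).real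
      {H | ¬ (frobNorm A / 2 ≤ frEst (bilinearSketch A H) ∧
        frEst (bilinearSketch A H) ≤ 2 * frobNorm A)} ≤ 0.01)
    {ε : ℝ} (hε : 0 < ε) (hε1 : ε < 1) (hkε : 34 + 600 * (Real.sqrt k * Real.log k) < ε * k) :
    (sketchTester d k m trEst frEst 150).IsL2Tester ε 0.9 := by
  intro A hA
  have hu := one_le_sqrt_mul_log (k := k) (by omega)
  set u := Real.sqrt k * Real.log k with hu_def
  have hgam : ∀ α β : ℝ, ∀ S : Matrix (Fin k) (Fin k) ℝ,
      gammaStat α β S = (α - lambdaMin S) / (β * u) := fun α β S => by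
    rw [gammaStat, hu_def, mul_assoc]
  rw [sketchTester_outputsTrue]
  let E : Set (Matrix (Fin d) (Fin k ⊕ Fin m) ℝ) :=
    {X | sketchAccepts trEst frEst 150 (bilinearSketch A X)}
  change MeasurableSet E ∧
    (A.PosSemidef → 0.9 ≤ (gaussianMatrix d (Fin k ⊕ Fin m)).real E) ∧
    (IsFarFromPSD ε A → 0.9 ≤ (gaussianMatrix d (Fin k ⊕ Fin m)).real Eᶜ)
  have htA := (real_preimage_colsRight_le (κ := Fin k) _).trans (htr A hA)
  have hfA := (real_preimage_colsRight_le (κ := Fin k) _).trans (hfr A hA)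
  refine ⟨measurableSet_sketchAccepts (by omega) ht hf 150 hA, fun hpsd => ?_, fun hfar => ?_⟩
  · have hS : ∀ X : Matrix (Fin d) (Fin k ⊕ Fin m) ℝ,
        (bilinearSketch A X).toBlocks₁₁.PosSemidef := fun X => by
      rw [bilinearSketch_toBlocks₁₁, bilinearSketch, ← Matrix.conjTranspose_eq_transpose_of_trivial]
      exact hpsd.conjTranspose_mul_mul_same _
    rcases eq_or_ne A 0 with rfl | h0
    · have hfr0 : frobNorm (0 : Matrix (Fin d) (Fin d) ℝ) = 0 := frobNorm_zero
      refine one_sub_le_measureReal hfA (by norm_num) fun X hX => ⟨hS X, ?_⟩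
      have hX' := not_not.1 hX
      rw [hfr0, zero_div, mul_zero] at hX'
      -- For `A = 0` the estimate `β` vanishes, and division by zero makes `γ = 0`, so the input is
      -- accepted.
      rw [hgam, bilinearSketch_toBlocks₂₂, le_antisymm hX'.2 hX'.1]
      norm_num
    have hF := frobNorm_pos h0
    have hlA := (real_preimage_colsLeft_le (κ' := Fin m) _).trans
      (real_lambdaMin_sketch_lt_le_of_posSemidef (k := k) (by omega) hpsd h0)
    refine one_sub_le_measureReal ((measureReal_union_le _ _).trans (add_le_add
      ((measureReal_union_le _ _).trans (add_le_add htA hfA)) hlA)) (by norm_num)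
      fun X hX => ⟨hS X, ?_⟩
    rw [Set.mem_union, Set.mem_union, not_or, not_or] at hX
    have hX1 : |trEst (bilinearSketch A (colsRight X)) - A.trace| ≤ frobNorm A := not_lt.1 hX.1.1
    have h1 := (abs_le.1 hX1).2
    have h2 := (not_not.1 hX.1.2).1
    have h3 : A.trace - (28 * Real.sqrt k * Real.log k + 45) * frobNorm A ≤
      lambdaMin (bilinearSketch A (colsLeft X)) := not_lt.1 hX.2
    rw [hgam, bilinearSketch_toBlocks₁₁, bilinearSketch_toBlocks₂₂]
    rw [mul_assoc, ← hu_def] at h3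
    have hβ : 0 < frEst (bilinearSketch A (colsRight X)) := lt_of_lt_of_le (by positivity) h2
    rw [div_le_iff₀ (by positivity)]
    have h4 := mul_le_mul_of_nonneg_right h2 (by linarith : 0 ≤ u)
    nlinarith [mul_le_mul_of_nonneg_left hu hF.le]
  · have hF := frobNorm_pos hfar.1
    have hlA := (real_preimage_colsLeft_le (κ' := Fin m) _).trans
      (real_le_lambdaMin_sketch_le_of_far (k := k) (by omega) hA hε hε1 hfar)
    have hk8 : (8 : ℝ) / k ≤ 0.01 := by
      rw [div_le_iff₀ (by positivity)]
      have : (1000 : ℝ) ≤ k := by exact_mod_cast hk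
      linarith
    refine one_sub_le_measureReal ((measureReal_union_le _ _).trans (add_le_add
      ((measureReal_union_le _ _).trans (add_le_add htA hfA)) hlA)) (by linarith)
      fun X hX hacc => ?_
    rw [Set.mem_union, Set.mem_union, not_or, not_or] at hX
    have hX1 : |trEst (bilinearSketch A (colsRight X)) - A.trace| ≤ frobNorm A := not_lt.1 hX.1.1
    have h1 := (abs_le.1 hX1).1
    have h2 := not_not.1 hX.1.2
    have h3 : lambdaMin (bilinearSketch A (colsLeft X)) <
      A.trace + (16 - ε * k / 2) * frobNorm A := not_le.1 hX.2
    have hγ := hacc.2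
    rw [hgam, bilinearSketch_toBlocks₁₁, bilinearSketch_toBlocks₂₂] at hγ
    have hβ : 0 < frEst (bilinearSketch A (colsRight X)) := lt_of_lt_of_le (by positivity) h2.1
    rw [div_le_iff₀ (by positivity)] at hγ
    have h4 := mul_le_mul_of_nonneg_right h2.2 (by linarith : 0 ≤ u)
    nlinarith [mul_lt_mul_of_pos_left hkε hF]

end Tester

/-! ### Choice of the sketch size. -/

section Parameters

theorem log_two_div_gt {ε : ℝ} (hε : 0 < ε) (hε1 : ε < 1) :
    0.69 < Real.log (2 / ε) := by
  refine lt_of_lt_of_le (by linarith [Real.log_two_gt_d9] : (0.69 : ℝ) < Real.log 2) ?_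
  refine Real.log_le_log (by norm_num) ?_
  rw [le_div_iff₀ hε]
  linarith

/-- The number of columns of `G`. -/
noncomputable def sketchSize (ε : ℝ) : ℕ :=
  ⌈(2 : ℝ) ^ 34 * ((1 / ε ^ 2) * Real.log (2 / ε) ^ 2)⌉₊

/-- This lower bound lets the leading term absorb the additive constants: the rounding in
`sketchSize` and the 3200 columns of `H`. -/
theorem quarter_lt_inv_sq_mul_log_sq {ε : ℝ} (hε : 0 < ε) (hε1 : ε < 1) :
    1 / 4 < (1 / ε ^ 2) * Real.log (2 / ε) ^ 2 := by
  have hL := log_two_div_gt hε hε1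
  have h1 : 1 ≤ 1 / ε ^ 2 := by
    rw [le_div_iff₀ (by positivity)]
    nlinarith
  nlinarith [sq_nonneg (Real.log (2 / ε))]

theorem thousand_le_sketchSize {ε : ℝ} (hε : 0 < ε) (hε1 : ε < 1) : 1000 ≤ sketchSize ε := by
  have h : (1000 : ℝ) ≤ sketchSize ε := by
    refine le_trans ?_ (Nat.le_ceil _)
    linarith [quarter_lt_inv_sq_mul_log_sq hε hε1]
  exact_mod_cast h

theorem sketchSize_add_le {ε : ℝ} (hε : 0 < ε) (hε1 : ε < 1) :
    ((sketchSize ε + 3200 : ℕ) : ℝ) ≤ 2 ^ 35 * ((1 / ε ^ 2) * Real.log (2 / ε) ^ 2) := by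
  have h := quarter_lt_inv_sq_mul_log_sq hε hε1
  have h2 := Nat.ceil_lt_add_one
    (show 0 ≤ (2 : ℝ) ^ 34 * ((1 / ε ^ 2) * Real.log (2 / ε) ^ 2) by positivity)
  push_cast
  unfold sketchSize
  linarith

theorem log_sketchSize_le {ε : ℝ} (hε : 0 < ε) (hε1 : ε < 1) :
    Real.log (sketchSize ε) ≤ 39 * Real.log (2 / ε) := by
  have hL := log_two_div_gt hε hε1
  have hk : (0 : ℝ) < sketchSize ε := by
    have := thousand_le_sketchSize hε hε1
    exact_mod_cast (by omega : 0 < sketchSize ε)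
  have hexp : Real.exp (Real.log (2 / ε)) = 2 / ε := Real.exp_log (by positivity)
  rw [Real.log_le_iff_le_exp hk, show (39 : ℝ) * Real.log (2 / ε) =
    (39 : ℕ) * Real.log (2 / ε) by norm_num, Real.exp_nat_mul, hexp]
  have h := sketchSize_add_le hε hε1
  push_cast at h
  have h2 : 2 ≤ 2 / ε := by
    rw [le_div_iff₀ hε]
    linarith
  have h1 : 1 / ε ≤ 2 / ε := by gcongr; norm_num
  have hLe : Real.log (2 / ε) ≤ 2 / ε := Real.log_le_self (by positivity)
  calc (sketchSize ε : ℝ) ≤ 2 ^ 35 * ((1 / ε) ^ 2 * Real.log (2 / ε) ^ 2) := by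
        rw [one_div_pow]; linarith
    _ ≤ (2 / ε) ^ 35 * ((2 / ε) ^ 2 * (2 / ε) ^ 2) := by gcongr
    _ = _ := by ring

/-- With `s = √k` and `L = log(2/ε)`, the size was chosen so that `sε ≥ 2¹⁷ L`, hence `εk ≥ 2¹⁷ sL`.
The left side is at most `34 + 600 · 39 · sL`, which is smaller because `sL ≥ 0.69`. -/
theorem sketchSize_large {ε : ℝ} (hε : 0 < ε) (hε1 : ε < 1) :
    34 + 600 * (Real.sqrt (sketchSize ε) * Real.log (sketchSize ε)) <
    ε * sketchSize ε := by
  have hL := log_two_div_gt hε hε1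
  set L := Real.log (2 / ε) with hLdef
  have hk : (0 : ℝ) ≤ sketchSize ε := Nat.cast_nonneg _
  set s := Real.sqrt (sketchSize ε) with hs
  have hss : s * s = sketchSize ε := Real.mul_self_sqrt hk
  have hs1 : 2 ^ 17 * L / ε ≤ s := by
    refine Real.le_sqrt_of_sq_le ?_
    refine le_trans (le_of_eq ?_) (Nat.le_ceil _)
    rw [← hLdef]
    field_simp
  rw [div_le_iff₀ hε] at hs1
  have hs0 : 1 ≤ s := by
    rw [hs, Real.one_le_sqrt]
    exact_mod_cast (by have := thousand_le_sketchSize hε hε1; omega : 1 ≤ sketchSize ε)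
  have hlog := log_sketchSize_le hε hε1
  rw [← hLdef] at hlog
  have h1 : s * Real.log (sketchSize ε) ≤ s * (39 * L) := by gcongr
  have h2 : s * (2 ^ 17 * L) ≤ s * (s * ε) := by gcongr
  have h3 : 0.69 ≤ s * L := by nlinarith
  have h4 : ε * sketchSize ε = s * (s * ε) := by rw [← hss]; ring
  rw [h4]
  linarith

end Parameters

end PSDTesting

open PSDTesting in
theorem mainTheorem3 :
    ∃ (m : ℕ) (trEst frEst : Matrix (Fin m) (Fin m) ℝ → ℝ) (cpsd C : ℝ),
      0 < cpsd ∧ 0 < C ∧ Measurable trEst ∧ Measurable frEst ∧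
      (∀ (d : ℕ) (A : Matrix (Fin d) (Fin d) ℝ), A.IsSymm →
        0.99 ≤ (gaussianMatrix d (Fin m)).real
          {H | |trEst (bilinearSketch A H) - A.trace| ≤ frobNorm A} ∧
        0.99 ≤ (gaussianMatrix d (Fin m)).real
          {H | frobNorm A / 2 ≤ frEst (bilinearSketch A H) ∧
            frEst (bilinearSketch A H) ≤ 2 * frobNorm A}) ∧
      ∀ ε : ℝ, 0 < ε → ε < 1 →
        ∃ k : ℕ, 0 < k ∧
          ((k + m : ℕ) : ℝ) ≤ C * (1 / ε ^ 2) * Real.log (2 / ε) ^ 2 ∧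
          ∀ d : ℕ,
            (sketchTester d k m trEst frEst cpsd).IsL2Tester ε 0.9 ∧
            ((sketchTester d k m trEst frEst cpsd).numQueries : ℝ) ≤
              C * (1 / ε ^ 4) * Real.log (2 / ε) ^ 4 := by
  -- The 3200 columns of `H` form the 1600 disjoint pairs of the norm estimate. The constant `C` is
  -- a square because the number of queries is `(k + m)²`.
  refine ⟨1600 + 1600, traceEstimate (1600 + 1600), frobEstimate 1600, 150, (2 ^ 35) ^ 2,
    by norm_num, by norm_num, measurable_traceEstimate _, measurable_frobEstimate _,
    fun d A hA => ⟨?_, ?_⟩, fun ε hε hε1 => ⟨sketchSize ε, ?_, ?_, fun d => ⟨?_, ?_⟩⟩⟩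
  · exact one_sub_le_measureReal
      (real_traceEstimate_deviation_le (m := 1600 + 1600) (by norm_num) hA) (by norm_num)
      fun H hH => (not_lt.1 hH : |traceEstimate (1600 + 1600) (bilinearSketch A H) - A.trace| ≤ _)
  · exact one_sub_le_measureReal (real_frobEstimate_deviation_le le_rfl hA) (by norm_num)
      fun H hH => not_not.1 hH
  · have := thousand_le_sketchSize hε hε1
    omega
  · have h := sketchSize_add_le hε hε1
    have hq := quarter_lt_inv_sq_mul_log_sq hε hε1
    rw [mul_assoc]
    refine h.trans ?_
    gcongr
    norm_num
  · exact sketchTester_isL2Tester (thousand_le_sketchSize hε hε1) (measurable_traceEstimate _)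
      (measurable_frobEstimate _) (fun A hA => real_traceEstimate_deviation_le (by norm_num) hA)
      (fun A hA => real_frobEstimate_deviation_le le_rfl hA) hε hε1 (sketchSize_large hε hε1)
  · have h := sketchSize_add_le hε hε1
    have hc : ((sketchTester d (sketchSize ε) (1600 + 1600) (traceEstimate (1600 + 1600))
        (frobEstimate 1600) 150).numQueries : ℝ) = ((sketchSize ε + 3200 : ℕ) : ℝ) ^ 2 := by
      rw [NonadaptiveVMV.numQueries, Fintype.card_prod, Fintype.card_sum, Fintype.card_fin,
        Fintype.card_fin]
      push_cast
      ring
    rw [hc]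
    calc _ ≤ (2 ^ 35 * ((1 / ε ^ 2) * Real.log (2 / ε) ^ 2)) ^ 2 := by gcongr
      _ = _ := by field_simp
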